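/- Let $\mathcal{S}$ be the class of all rooted plane trees $\tau$ such that, in every branch attached to the root of $\tau$, the rightmost leaf has odd distance to the root (\emph{Catalan--Stanley trees}; the tree consisting of just the root belongs to $\mathcal{S}$). The size of a tree is its number of nodes. The reduction $\rho\colon\mathcal{S}\to\mathcal{S}$ acts on $\tau\in\mathcal{S}$ as follows, simultaneously in all branches attached to the root: if the rightmost leaf of the branch is a child of the root, then this leaf is deleted; otherwise all subtrees of the grandparent of the rightmost leaf are deleted, so that the grandparent becomes a leaf. In particular, $\rho$ maps the tree of size one to itself. For $r\in\mathbb{Z}_{\ge 0}$, the $r$-th ancestor of $\tau$ is $\rho^r(\tau)$. **Theorem.** Let $r\in\mathbb{Z}_{\ge 0}$ be fixed, and let $X_{n,r}$ be the size of the $r$-th ancestor of a uniformly random Catalan--Stanley tree of size $n$. Then, as $n\to\infty$, $$\mathbb{E} X_{n,r} = \frac{1}{4^{r}} n + \frac{2\cdot 4^{r} - 2r^{2} + r - 2}{2\cdot 4^{r}} + \frac{(2r+1)(2r-1)(r-3)r}{2\cdot 4^{r+1}}\, n^{-1} + O(n^{-3/2})$$ and $$\begin{aligned}\mathbb{V}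 X_{n,r} ={}& \frac{(2^{r}+1)(2^{r}-1)}{16^{r}}\, n^{2} - \frac{\sqrt{\pi}\,(4^{r}(3r+1)-1)}{3\cdot 16^{r}}\, n^{3/2} \\ &+ \frac{18\cdot 4^{r} r^{2} + 3\cdot 4^{r} r - 38\cdot 4^{r} + 36 r^{2} - 42 r + 38}{18\cdot 16^{r}}\, n + \frac{5\sqrt{\pi}\,(4^{r}(3r+1)-1)}{8\cdot 16^{r}}\, n^{1/2} + O(1),\end{aligned}$$ where the implied constants may depend on $r$. -/

import Mathlib

open Filter MeasureTheory ProbabilityTheory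
open scoped Topology

/-- Rooted plane (ordered) trees. `node cs` is the tree whose root has the ordered list `cs` of
branches attached to it. Throughout, the children of a node are listed **from right to left**,
so that the head of the list is the rightmost child. -/
inductive PlaneTree : Type
  | node (children : List PlaneTree) : PlaneTree

namespace PlaneTree

/-- The tree consisting of a single node. -/
def leaf : PlaneTree := node []

/-- The list of branches attached to the root, from right to left. -/
def children : PlaneTree → List PlaneTree
  | node cs => cs

/-- The size of a plane tree is its number of nodes. -/
def size : PlaneTree → ℕ
  | node cs => 1 + (cs.map size).sum

/-- The distance from the root of the tree to its rightmost leaf, i.e. the leaf that is reached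
by passing to the rightmost child as long as possible. -/
def rightDepth : PlaneTree → ℕ
  | node [] => 0
  | node (c :: _) => rightDepth c + 1

/-- `pruneAt k t` deletes all subtrees of the node at distance `k` from the root on the path from
the root of `t` to its rightmost leaf (so that this node becomes a leaf). -/
def pruneAt : ℕ → PlaneTree → PlaneTree
  | 0, _ => leaf
  | _ + 1, node [] => leaf
  | k + 1, node (c :: cs) => node (pruneAt k c :: cs)

/-- A Catalan--Stanley tree: in every branch attached to the root, the rightmost leaf has odd
distance to the root of the whole tree. (The root of a branch has distance `1` to the root of
the whole tree.) -/
def IsCatalanStanley (t : PlaneTree) : Prop :=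
  ∀ b ∈ t.children, Odd (b.rightDepth + 1)

/-- The reduction of one branch `b` attached to the root: if the rightmost leaf of the branch is a
child of the root, it is deleted; otherwise all subtrees of the grandparent of the rightmost leaf
are deleted. (The grandparent has distance `b.rightDepth - 2` to the root of `b`; in a
Catalan--Stanley tree, `b.rightDepth` is even, hence at least `2` in the second case.) -/
def reduceBranch (b : PlaneTree) : Option PlaneTree :=
  if b.rightDepth = 0 then none else some (pruneAt (b.rightDepth - 2) b)

/-- The tree reduction: all branches attached to the root are reduced simultaneously. -/
def reduce (t : PlaneTree) : PlaneTree :=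
  node (t.children.filterMap reduceBranch)

theorem size_node (cs : List PlaneTree) : (node cs).size = 1 + (cs.map size).sum := by
  rw [size]

theorem rightDepth_pruneAt : ∀ (k : ℕ) (t : PlaneTree), k ≤ t.rightDepth →
    (pruneAt k t).rightDepth = k
  | 0, _, _ => by simp [pruneAt, leaf, rightDepth]
  | k + 1, node [], h => by simp [rightDepth] at h
  | k + 1, node (c :: cs), h => by
    have := rightDepth_pruneAt k c (by simpa [rightDepth] using h)
    simp [pruneAt, rightDepth, this]

/-- The reduction maps Catalan--Stanley trees to Catalan--Stanley trees. -/
theorem IsCatalanStanley.reduce {t : PlaneTree} (ht : t.IsCatalanStanley) :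
    t.reduce.IsCatalanStanley := by
  intro b hb
  simp only [PlaneTree.reduce, children, List.mem_filterMap, reduceBranch] at hb
  obtain ⟨a, ha, hab⟩ := hb
  split_ifs at hab with h0
  have h1 : Odd (a.rightDepth + 1) := ht a ha
  have h2 : b = pruneAt (a.rightDepth - 2) a := by simpa using hab.symm
  rw [h2, rightDepth_pruneAt _ _ (Nat.sub_le _ _)]
  grind

/-- The set of Catalan--Stanley trees of size `n`. -/
def catalanStanley (n : ℕ) : Set PlaneTree :=
  {t | t.IsCatalanStanley ∧ t.size = n}

theorem one_le_size (t : PlaneTree) : 1 ≤ t.size := by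
  cases t
  rw [size_node]
  omega

theorem finite_size_le (n : ℕ) : {t : PlaneTree | t.size ≤ n}.Finite := by
  induction n with
  | zero =>
    convert Set.finite_empty
    ext t
    have := one_le_size t
    simp
    omega
  | succ n ih =>
    have : Finite {t : PlaneTree // t.size ≤ n} := ih
    refine ((List.finite_length_le {t : PlaneTree // t.size ≤ n} n).image
      (fun l => node (l.map Subtype.val))).subset ?_
    rintro ⟨cs⟩ h
    rw [Set.mem_ofPred_eq, size_node] at h
    have hm : ∀ c ∈ cs, c.size ≤ n := fun c hc => by
      have := List.single_le_sum (l := cs.map size) (by simp) _ (List.mem_map_of_mem hc)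
      omega
    refine ⟨cs.attach.map (fun c => ⟨c.1, hm c.1 c.2⟩), ?_, ?_⟩
    · have := List.length_le_sum_of_one_le (cs.map size) (by simp [one_le_size])
      simp only [List.length_map] at this
      simp only [Set.mem_ofPred_eq, List.length_map, List.length_attach]
      omega
    · simp [List.map_map, Function.comp_def]

theorem finite_catalanStanley (n : ℕ) : (catalanStanley n).Finite :=
  (finite_size_le n).subset fun _ h => h.2.le

theorem catalanStanley_nonempty {n : ℕ} (hn : 1 ≤ n) : (catalanStanley n).Nonempty := by
  refine ⟨node (List.replicate (n - 1) leaf), ?_, ?_⟩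
  · intro b hb
    have : b = leaf := by simpa using List.eq_of_mem_replicate hb
    simp [this, leaf, rightDepth]
  · simp [size_node, leaf]
    omega

/-- The set of plane trees carries the discrete σ-algebra. -/
instance : MeasurableSpace PlaneTree := ⊤

instance : DiscreteMeasurableSpace PlaneTree := ⟨fun _ => trivial⟩

/-- The law of a uniformly random Catalan--Stanley tree of size `n`. -/
noncomputable def uniformCS (n : ℕ) : Measure PlaneTree :=
  uniformOn (catalanStanley n)

theorem isProbabilityMeasure_uniformCS {n : ℕ} (hn : 1 ≤ n) :
    IsProbabilityMeasure (uniformCS n) :=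
  isProbabilityMeasure_uniformOn (finite_catalanStanley n) (catalanStanley_nonempty hn)

/-- The size of the `r`-th ancestor (the `r`-fold reduction) of a tree, as a real random
variable. -/
def ancestorSize (r : ℕ) (t : PlaneTree) : ℝ :=
  ((reduce^[r] t).size : ℝ)

end PlaneTree

/-! The proof computes the first two binomial moments exactly as power series, then extracts their
coefficients elementarily, with no complex singularity analysis.

Let `z` mark nodes and `v` the nodes surviving in the ancestor. Write `T` for the plane tree series,
`T (1 - T) = z`, and `P` for the same series with every node weighted `z v`. A branch whose right
path has length `d` is counted by `z T ^ d`. It vanishes under `r` reductions when `d < 2r`;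
otherwise the lowest `2r` levels of its path are cut, and the path that remains has even length.
Summing over that length, the branches have series `B = z ∑_{i<r} T ^ (2i) + v z T ^ (2r) / (1 - P ^
2)`, and the trees have series `F = z v / (1 - B)`, because the reduction acts on each branch
separately.

Putting `v = 1 + X` makes the coefficient of `X ^ k` the generating function of the `k`-th binomial
moments. For `k = 0, 1, 2` these are explicit in `T` (`ancestorSeries_coeffs`); the count of trees
turns out to be `z (1 + T)`, so the moments are normalised by a Catalan number.

With `s = 1 - 2T = √(1 - 4z)`, the first moment is, up to harmless terms, a polynomial in `s` over
`s`, the second a polynomial over `s ^ 3`. Odd powers of `s` have coefficients equal to a rational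
function times a Catalan number, nonnegative even powers contribute nothing eventually, and `s⁻²`
gives `4 ^ m`. High powers are negligible (`coeffBound_pow_mul_aeval`). Hence the expectation
expands in integer powers of `n`, while the half-integer powers in the variance all come from `4 ^
m` over a Catalan number, which Wallis' product controls (`abs_four_pow_div_treeCount_sub_le`). -/

/-- The generating function of the weights `w a`, where `a` is counted with size `s a`. -/
noncomputable def weightSeries {α R : Type*} [CommRing R] (s : α → ℕ) (w : α → R) :
    PowerSeries R :=
  PowerSeries.mk fun n => ∑ᶠ a ∈ {a | s a = n}, w a

/-! ### Weighted generating functions -/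

section weightSeries

variable {α β R : Type*} [CommRing R] {s : α → ℕ} {t : β → ℕ}

theorem coeff_weightSeries (s : α → ℕ) (w : α → R) (n : ℕ) :
    (weightSeries s w).coeff n = ∑ᶠ a ∈ {a | s a = n}, w a := by
  simp [weightSeries]

theorem weightSeries_congr (s : α → ℕ) {w u : α → R} (h : ∀ a, w a = u a) :
    weightSeries s w = weightSeries s u := by
  rw [funext h]

theorem weightSeries_add (hs : ∀ n, {a | s a = n}.Finite) (w u : α → R) :
    weightSeries s (fun a => w a + u a) = weightSeries s w + weightSeries s u := by
  ext n
  simp only [coeff_weightSeries, map_add]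
  exact finsum_mem_add_distrib (hs n)

theorem weightSeries_sum {ι : Type*} (hs : ∀ n, {a | s a = n}.Finite) (I : Finset ι)
    (w : ι → α → R) :
    weightSeries s (fun a => ∑ i ∈ I, w i a) = ∑ i ∈ I, weightSeries s (w i) := by
  classical
  induction I using Finset.induction_on with
  | empty => ext n; simp [coeff_weightSeries]
  | insert i I hi ih =>
    rw [Finset.sum_insert hi, ← ih, ← weightSeries_add hs]
    exact weightSeries_congr s fun a => Finset.sum_insert hi

theorem weightSeries_const_mul (hs : ∀ n, {a | s a = n}.Finite) (k : R) (w : α → R) :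
    weightSeries s (fun a => k * w a) = PowerSeries.C k * weightSeries s w := by
  ext n
  rw [PowerSeries.coeff_C_mul, coeff_weightSeries, coeff_weightSeries,
    finsum_mem_eq_finite_toFinset_sum _ (hs n), finsum_mem_eq_finite_toFinset_sum _ (hs n),
    Finset.mul_sum]

theorem finite_add_fiber (hs : ∀ n, {a | s a = n}.Finite) (ht : ∀ n, {b | t b = n}.Finite)
    (n : ℕ) : {p : α × β | s p.1 + t p.2 = n}.Finite := by
  refine ((Finset.HasAntidiagonal.antidiagonal n).finite_toSet.biUnion
    fun ij _ => (hs ij.1).prod (ht ij.2)).subset ?_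
  intro p hp
  simp only [Set.mem_iUnion]
  exact ⟨(s p.1, t p.2), by simpa using hp, rfl, rfl⟩

theorem weightSeries_mul (hs : ∀ n, {a | s a = n}.Finite) (ht : ∀ n, {b | t b = n}.Finite)
    (w : α → R) (u : β → R) :
    weightSeries (fun p : α × β => s p.1 + t p.2) (fun p => w p.1 * u p.2) =
      weightSeries s w * weightSeries t u := by
  classical
  ext n
  simp only [PowerSeries.coeff_mul, coeff_weightSeries]
  rw [finsum_mem_eq_finite_toFinset_sum _ (finite_add_fiber hs ht n),
    ← Finset.sum_fiberwise_of_maps_to (t := Finset.HasAntidiagonal.antidiagonal n)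
      (g := fun p : α × β => (s p.1, t p.2)) (by simp)]
  refine Finset.sum_congr rfl fun ij hij => ?_
  rw [finsum_mem_eq_finite_toFinset_sum _ (hs _), finsum_mem_eq_finite_toFinset_sum _ (ht _),
    Finset.sum_mul_sum, ← Finset.sum_product']
  refine Finset.sum_congr ?_ fun _ _ => rfl
  rw [Finset.HasAntidiagonal.mem_antidiagonal] at hij
  ext p
  simp only [Finset.mem_filter, Set.Finite.mem_toFinset, Set.mem_ofPred_eq, Finset.mem_product,
    Prod.ext_iff]
  omega

end weightSeries

/-! ### Root decompositions of plane trees -/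

namespace PlaneTree

variable {R : Type*} [CommRing R]

/-- The number of nodes of a list of plane trees. -/
def listSize (cs : List PlaneTree) : ℕ := (cs.map size).sum

@[simp] theorem listSize_nil : listSize [] = 0 := rfl

@[simp] theorem listSize_cons (c : PlaneTree) (cs : List PlaneTree) :
    listSize (c :: cs) = c.size + listSize cs := by simp [listSize]

theorem size_node_eq (cs : List PlaneTree) : (node cs).size = listSize cs + 1 := by
  rw [size_node, listSize, add_comm]

theorem finite_size_eq (n : ℕ) : {t : PlaneTree | t.size = n}.Finite :=
  (finite_size_le n).subset fun _ h => le_of_eq h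

theorem node_injective : Function.Injective node := fun _ _ h => by simpa using h

theorem finite_listSize_eq (n : ℕ) : {cs : List PlaneTree | listSize cs = n}.Finite := by
  refine ((finite_size_eq (n + 1)).preimage node_injective.injOn).subset fun cs h => ?_
  rw [Set.mem_preimage, Set.mem_ofPred_eq, size_node_eq, h]

theorem weightSeries_size (w : PlaneTree → R) :
    weightSeries size w = PowerSeries.X * weightSeries listSize (fun cs => w (node cs)) := by
  ext n
  cases n with
  | zero =>
    have : {t : PlaneTree | t.size = 0} = ∅ := by
      ext t
      have := one_le_size t
      simp
      omega
    rw [coeff_weightSeries, this]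
    simp
  | succ n =>
    have : {t : PlaneTree | t.size = n + 1} = node '' {cs | listSize cs = n} := by
      ext t
      cases t
      simp [size_node_eq]
    rw [coeff_weightSeries, this, finsum_mem_image node_injective.injOn,
      PowerSeries.coeff_succ_X_mul, coeff_weightSeries]

theorem weightSeries_listSize (φ : List PlaneTree → R) :
    weightSeries listSize φ = PowerSeries.C (φ []) +
      weightSeries (fun p : PlaneTree × List PlaneTree => p.1.size + listSize p.2)
        (fun p => φ (p.1 :: p.2)) := by
  ext n
  rw [map_add, coeff_weightSeries, coeff_weightSeries, PowerSeries.coeff_C]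
  cases n with
  | zero =>
    have h1 : {cs : List PlaneTree | listSize cs = 0} = {[]} := by
      ext cs
      cases cs with
      | nil => simp
      | cons c cs =>
        have := one_le_size c
        simp
        omega
    have h2 : {p : PlaneTree × List PlaneTree | p.1.size + listSize p.2 = 0} = ∅ := by
      ext p
      have := one_le_size p.1
      simp
      omega
    rw [h1, h2]
    simp
  | succ n =>
    have h : {cs : List PlaneTree | listSize cs = n + 1} =
        (fun p : PlaneTree × List PlaneTree => p.1 :: p.2) ''
          {p | p.1.size + listSize p.2 = n + 1} := by
      ext cs
      cases cs with
      | nil => simp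
      | cons c cs => simp
    rw [h, finsum_mem_image fun p _ q _ hpq => by simpa [Prod.ext_iff] using hpq]
    simp

/-- The generating function of lists of trees with a multiplicative weight. -/
noncomputable def listSeries (w : PlaneTree → R) : PowerSeries R :=
  weightSeries listSize fun cs => (cs.map w).prod

theorem listSeries_eq (w : PlaneTree → R) :
    listSeries w = 1 + weightSeries size w * listSeries w := by
  conv_lhs => rw [listSeries, weightSeries_listSize]
  simp only [List.map_nil, List.prod_nil, map_one, List.map_cons, List.prod_cons]
  rw [weightSeries_mul finite_size_eq finite_listSize_eq w fun cs => (cs.map w).prod, listSeries]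

/-- Lists give a geometric series. It is stated without inverses because the coefficient ring will
be a polynomial ring. -/
theorem one_sub_mul_listSeries (w : PlaneTree → R) :
    (1 - weightSeries size w) * listSeries w = 1 := by
  linear_combination listSeries_eq w

/-- First-branch decomposition of trees: the weight of a tree factors into a weight of the
rightmost branch and a multiplicative weight of the other branches. -/
theorem weightSeries_of_cons (φ α w : PlaneTree → R)
    (h : ∀ c cs, φ (node (c :: cs)) = α c * (cs.map w).prod) :
    weightSeries size φ =
      PowerSeries.X * (PowerSeries.C (φ leaf) + weightSeries size α * listSeries w) := by
  rw [weightSeries_size, weightSeries_listSize]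
  simp only [h]
  rw [weightSeries_mul finite_size_eq finite_listSize_eq α fun cs => (cs.map w).prod]
  rfl

theorem weightSeries_of_prod (φ w : PlaneTree → R) (k : R)
    (h : ∀ cs, φ (node cs) = k * (cs.map w).prod) :
    weightSeries size φ = PowerSeries.X * PowerSeries.C k * listSeries w := by
  rw [weightSeries_size]
  simp only [h]
  rw [weightSeries_const_mul finite_listSize_eq, listSeries, mul_assoc]

theorem pow_listSize (v : R) (cs : List PlaneTree) :
    v ^ listSize cs = (cs.map fun t => v ^ t.size).prod := by
  induction cs with
  | nil => simp
  | cons c cs ih => simp [pow_add, ih]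

/-- The generating function of all plane trees, where every node has weight `v`. -/
noncomputable def treeSeries (v : R) : PowerSeries R :=
  weightSeries size fun t => v ^ t.size

theorem treeSeries_eq_mul_listSeries (v : R) :
    treeSeries v = PowerSeries.X * PowerSeries.C v * listSeries fun t => v ^ t.size := by
  refine weightSeries_of_prod _ _ v fun cs => ?_
  rw [size_node_eq, pow_succ', pow_listSize]

theorem treeSeries_mul (v : R) :
    treeSeries v * (1 - treeSeries v) = PowerSeries.X * PowerSeries.C v := by
  have := one_sub_mul_listSeries fun t : PlaneTree => v ^ t.size
  rw [← treeSeries] at this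
  linear_combination (1 - treeSeries v) * treeSeries_eq_mul_listSeries v +
    PowerSeries.X * PowerSeries.C v * this

/-! ### Right paths and the `r`-fold reduction -/

theorem pruneAt_pruneAt : ∀ (k m : ℕ) (t : PlaneTree), k ≤ m → pruneAt k (pruneAt m t) = pruneAt k t
  | 0, _, _, _ => by simp [pruneAt]
  | k + 1, m + 1, node [], _ => by simp [pruneAt, leaf]
  | k + 1, m + 1, node (c :: cs), h => by
    simp [pruneAt, pruneAt_pruneAt k m c (by omega)]

theorem pruneAt_rightDepth : ∀ t : PlaneTree, pruneAt t.rightDepth t = t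
  | node [] => by simp [rightDepth, pruneAt, leaf]
  | node (c :: cs) => by simp [rightDepth, pruneAt, pruneAt_rightDepth c]

/-- The `r`-fold reduction of a branch. -/
def ancestorBranch (r : ℕ) (b : PlaneTree) : Option PlaneTree :=
  if b.rightDepth < 2 * r then none else some (pruneAt (b.rightDepth - 2 * r) b)

/-- Parity is what makes the two case distinctions agree: the remaining right path has even length,
so being shorter than `2` means being `0`. -/
theorem ancestorBranch_succ (r : ℕ) {b : PlaneTree} (hb : Even b.rightDepth) :
    (ancestorBranch r b).bind reduceBranch = ancestorBranch (r + 1) b := by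
  unfold ancestorBranch
  by_cases h : b.rightDepth < 2 * r
  · rw [if_pos h, if_pos (by omega)]
    rfl
  · rw [if_neg h, Option.bind_some, reduceBranch, rightDepth_pruneAt _ _ (Nat.sub_le _ _)]
    by_cases h' : b.rightDepth < 2 * (r + 1)
    · rw [if_pos h', if_pos (by grind)]
    · rw [if_neg h', if_neg (by omega), pruneAt_pruneAt _ _ _ (Nat.sub_le _ _)]
      congr 2

theorem isCatalanStanley_node {cs : List PlaneTree} :
    (node cs).IsCatalanStanley ↔ ∀ b ∈ cs, Even b.rightDepth := by
  simp only [IsCatalanStanley, children]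
  refine forall₂_congr fun b _ => ?_
  grind

theorem iterate_reduce_node (r : ℕ) {cs : List PlaneTree} (h : ∀ b ∈ cs, Even b.rightDepth) :
    reduce^[r] (node cs) = node (cs.filterMap (ancestorBranch r)) := by
  induction r with
  | zero =>
    have : ancestorBranch 0 = some := by
      funext b
      simp [ancestorBranch, pruneAt_rightDepth]
    rw [this, List.filterMap_some, Function.iterate_zero, id]
  | succ r ih =>
    rw [Function.iterate_succ_apply', ih, reduce, children, List.filterMap_filterMap]
    congr 1
    exact List.filterMap_congr fun b hb => ancestorBranch_succ r (h b hb)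

/-- The weight `v ^ s` of a branch, where `s` is the size of the `r`-fold reduction. -/
noncomputable def branchWeight (v : R) (r : ℕ) (b : PlaneTree) : R :=
  open Classical in
  if Even b.rightDepth then
    if b.rightDepth < 2 * r then 1 else v ^ (pruneAt (b.rightDepth - 2 * r) b).size
  else 0

/-- The weight `v ^ s` of a Catalan--Stanley tree, where `s` is the size of its `r`-th ancestor. -/
noncomputable def ancestorWeight (v : R) (r : ℕ) (t : PlaneTree) : R :=
  open Classical in if t.IsCatalanStanley then v ^ (reduce^[r] t).size else 0

/-- The reduction works branch by branch, and a branch of the wrong parity contributes a zero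
factor, so the weight is multiplicative. -/
theorem ancestorWeight_node (v : R) (r : ℕ) (cs : List PlaneTree) :
    ancestorWeight v r (node cs) = v * (cs.map (branchWeight v r)).prod := by
  unfold ancestorWeight
  rw [isCatalanStanley_node]
  split_ifs with h
  · rw [iterate_reduce_node r h, size_node_eq, pow_succ']
    congr 1
    induction cs with
    | nil => simp
    | cons c cs ih =>
      rw [List.map_cons, List.prod_cons, ← ih fun b hb => h b (List.mem_cons_of_mem _ hb),
        branchWeight, if_pos (h c List.mem_cons_self), List.filterMap_cons, ancestorBranch]
      split_ifs <;> simp [pow_add]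
  · push Not at h
    obtain ⟨b, hb, hb'⟩ := h
    rw [List.prod_eq_zero, mul_zero]
    refine List.mem_map.2 ⟨b, hb, ?_⟩
    rw [branchWeight, if_neg (by simpa using hb')]

/-- The indicator of the trees whose rightmost leaf has distance `d` to the root. -/
def depthWeight (R : Type*) [CommRing R] (d : ℕ) (b : PlaneTree) : R :=
  if b.rightDepth = d then 1 else 0

/-- Each of the `d` inner nodes on the right path carries an arbitrary list of further subtrees,
which gives a factor `T`; the final leaf gives `X`. -/
theorem weightSeries_depthWeight (d : ℕ) :
    weightSeries size (depthWeight R d) = PowerSeries.X * treeSeries (1 : R) ^ d := by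
  induction d with
  | zero =>
    rw [weightSeries_of_cons (depthWeight R 0) (fun _ => 0) (fun _ => 0)
      fun c cs => by simp [depthWeight, rightDepth]]
    have : weightSeries size (fun _ : PlaneTree => (0 : R)) = 0 := by
      ext n; simp [coeff_weightSeries]
    simp [this, depthWeight, leaf, rightDepth]
  | succ d ih =>
    rw [weightSeries_of_cons (depthWeight R (d + 1)) (depthWeight R d) (fun t => 1 ^ t.size)
      fun c cs => by simp [depthWeight, rightDepth], ih]
    have := treeSeries_eq_mul_listSeries (1 : R)
    simp only [map_one, mul_one] at this
    rw [pow_succ]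
    nth_rw 3 [this]
    simp [depthWeight, leaf, rightDepth]
    ring

/-- The weight of the trees whose right path has length `k + j`, `j` of the same parity as `p`,
where only what remains after cutting the path to length `j` is counted. -/
noncomputable def keptWeight (v : R) (k p : ℕ) (b : PlaneTree) : R :=
  if k ≤ b.rightDepth ∧ Even (b.rightDepth - k + p) then v ^ (pruneAt (b.rightDepth - k) b).size
  else 0

/-- The part of `keptWeight` in which the right path does not vanish. -/
noncomputable def keptConsWeight (v : R) (k p : ℕ) : PlaneTree → R
  | node [] => 0
  | node (c :: cs) => v * keptWeight v k (p + 1) c * (cs.map fun t => v ^ t.size).prod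

theorem size_leaf : leaf.size = 1 := by simp [leaf, size_node]

/-- Either the root is the cut point, and a single node is kept, or the root lies above it, and
passing to the rightmost child flips the parity `p`. -/
theorem keptWeight_eq (v : R) (k p : ℕ) (b : PlaneTree) :
    keptWeight v k p b =
      (if Even p then v else 0) * depthWeight R k b + keptConsWeight v k p b := by
  rcases b with ⟨_ | ⟨c, cs⟩⟩
  · by_cases hk : k = 0
    · simp [keptWeight, rightDepth, depthWeight, keptConsWeight, hk, pruneAt, size_leaf]
    · simp [keptWeight, rightDepth, depthWeight, keptConsWeight, hk, Ne.symm hk]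
  · rw [keptConsWeight, keptWeight, keptWeight, depthWeight, rightDepth, ← pow_listSize]
    rcases lt_trichotomy (c.rightDepth + 1) k with h | h | h
    · simp [show ¬k ≤ c.rightDepth + 1 by omega, show ¬k ≤ c.rightDepth by omega, h.ne]
    · subst h
      simp [pruneAt, size_leaf]
    · rw [if_neg h.ne', Nat.sub_add_comm (by omega : k ≤ c.rightDepth)]
      simp only [show k ≤ c.rightDepth + 1 by omega, show k ≤ c.rightDepth by omega, true_and,
        add_assoc, add_comm 1 p, mul_zero, zero_add]
      split_ifs
      · rw [pruneAt, size_node_eq, listSize_cons]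
        ring
      · simp

theorem keptWeight_add_two (v : R) (k p : ℕ) : keptWeight v k (p + 2) = keptWeight v k p := by
  funext b
  unfold keptWeight
  congr 1
  simp only [← add_assoc, eq_iff_iff]
  grind

theorem weightSeries_keptWeight_aux (v : R) (k p : ℕ) :
    weightSeries size (keptWeight v k p) =
      PowerSeries.C (if Even p then v else 0) * (PowerSeries.X * treeSeries (1 : R) ^ k) +
        treeSeries v * weightSeries size (keptWeight v k (p + 1)) := by
  rw [weightSeries_congr size (keptWeight_eq v k p), weightSeries_add finite_size_eq,
    weightSeries_const_mul finite_size_eq, weightSeries_depthWeight,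
    weightSeries_of_cons (keptConsWeight v k p) (fun c => v * keptWeight v k (p + 1) c)
      (fun t => v ^ t.size) fun c cs => by rw [keptConsWeight],
    weightSeries_const_mul finite_size_eq, treeSeries_eq_mul_listSeries v]
  simp only [leaf, keptConsWeight, map_zero]
  ring

/-- Two steps of the recursion restore the parity; eliminating the odd class sums the geometric
series over kept paths of even length. -/
theorem weightSeries_keptWeight (v : R) (k : ℕ) :
    weightSeries size (keptWeight v k 0) * (1 - treeSeries v ^ 2) =
      PowerSeries.C v * (PowerSeries.X * treeSeries (1 : R) ^ k) := by
  have h0 := weightSeries_keptWeight_aux v k 0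
  have h1 := weightSeries_keptWeight_aux v k (0 + 1)
  rw [keptWeight_add_two] at h1
  simp only [zero_add, Nat.not_even_one, if_false, map_zero, zero_mul] at h0 h1
  rw [if_pos Even.zero] at h0
  linear_combination h0 + treeSeries v * h1

/-- The vanishing branches are sorted by their right depth `2 * i < 2 * r`. -/
theorem branchWeight_eq (v : R) (r : ℕ) (b : PlaneTree) :
    branchWeight v r b =
      ∑ i ∈ Finset.range r, depthWeight R (2 * i) b + keptWeight v (2 * r) 0 b := by
  unfold branchWeight keptWeight depthWeight
  by_cases he : Even b.rightDepth
  · obtain ⟨d, hd⟩ := he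
    rw [← two_mul] at hd
    rw [hd, if_pos (even_two_mul d)]
    simp only [Nat.mul_right_inj two_ne_zero, Finset.sum_ite_eq, Finset.mem_range]
    by_cases hr : d < r
    · rw [if_pos hr, if_pos (by omega), if_neg (by omega), add_zero]
    · rw [if_neg hr, if_neg (by omega), if_pos ⟨by omega, by rw [← Nat.mul_sub]; simp⟩, zero_add]
  · rw [if_neg he, Finset.sum_eq_zero fun i _ => if_neg fun h : b.rightDepth = 2 * i =>
        he (h ▸ even_two_mul i),
      if_neg, add_zero]
    rintro ⟨h1, h2⟩
    exact he (by grind)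

/-- The generating function of Catalan--Stanley trees, with weight `v ^ s` where `s` is the size
of the `r`-th ancestor. -/
noncomputable def ancestorSeries (v : R) (r : ℕ) : PowerSeries R :=
  weightSeries size (ancestorWeight v r)

theorem ancestorSeries_mul (v : R) (r : ℕ) :
    ancestorSeries v r * (1 - weightSeries size (branchWeight v r)) =
      PowerSeries.X * PowerSeries.C v := by
  rw [ancestorSeries, weightSeries_of_prod _ (branchWeight v r) v (ancestorWeight_node v r)]
  linear_combination PowerSeries.X * PowerSeries.C v * one_sub_mul_listSeries (branchWeight v r)

theorem weightSeries_branchWeight (v : R) (r : ℕ) :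
    weightSeries size (branchWeight v r) =
      ∑ i ∈ Finset.range r, PowerSeries.X * treeSeries (1 : R) ^ (2 * i) +
        weightSeries size (keptWeight v (2 * r) 0) := by
  rw [weightSeries_congr size (branchWeight_eq v r), weightSeries_add finite_size_eq,
    weightSeries_sum finite_size_eq]
  simp only [weightSeries_depthWeight]

end PlaneTree

/-! ### Taylor coefficients in the marking variable -/

/-- The power series formed by the `k`-th coefficients of the coefficients of a power series over
a polynomial ring. -/
noncomputable def innerCoeff (k : ℕ) : PowerSeries (Polynomial ℝ) →+ PowerSeries ℝ where
  toFun F := PowerSeries.mk fun n => (F.coeff n).coeff k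
  map_zero' := by ext; simp
  map_add' F G := by ext; simp

theorem coeff_innerCoeff (k n : ℕ) (F : PowerSeries (Polynomial ℝ)) :
    (innerCoeff k F).coeff n = (F.coeff n).coeff k := by simp [innerCoeff]

theorem innerCoeff_mul (k : ℕ) (F G : PowerSeries (Polynomial ℝ)) :
    innerCoeff k (F * G) =
      ∑ ij ∈ Finset.HasAntidiagonal.antidiagonal k, innerCoeff ij.1 F * innerCoeff ij.2 G := by
  ext n
  simp only [coeff_innerCoeff, PowerSeries.coeff_mul, Polynomial.finsetSum_coeff,
    Polynomial.coeff_mul, map_sum]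
  exact Finset.sum_comm

theorem innerCoeff_zero_mul (F G : PowerSeries (Polynomial ℝ)) :
    innerCoeff 0 (F * G) = innerCoeff 0 F * innerCoeff 0 G := by
  simp [innerCoeff_mul]

theorem innerCoeff_one_mul (F G : PowerSeries (Polynomial ℝ)) :
    innerCoeff 1 (F * G) = innerCoeff 0 F * innerCoeff 1 G + innerCoeff 1 F * innerCoeff 0 G := by
  simp [innerCoeff_mul, Finset.Nat.antidiagonal_succ]

theorem innerCoeff_two_mul (F G : PowerSeries (Polynomial ℝ)) :
    innerCoeff 2 (F * G) = innerCoeff 0 F * innerCoeff 2 G + innerCoeff 1 F * innerCoeff 1 G +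
      innerCoeff 2 F * innerCoeff 0 G := by
  simp [innerCoeff_mul, Finset.Nat.antidiagonal_succ, add_assoc]

theorem innerCoeff_map_C (k : ℕ) (G : PowerSeries ℝ) :
    innerCoeff k (PowerSeries.map Polynomial.C G) = if k = 0 then G else 0 := by
  ext n
  rw [coeff_innerCoeff, PowerSeries.coeff_map, Polynomial.coeff_C]
  split_ifs <;> simp

theorem innerCoeff_C (k : ℕ) (p : Polynomial ℝ) :
    innerCoeff k (PowerSeries.C p) = PowerSeries.C (p.coeff k) := by
  ext n
  rw [coeff_innerCoeff, PowerSeries.coeff_C, PowerSeries.coeff_C]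
  split_ifs <;> simp

theorem innerCoeff_weightSeries {α : Type*} {s : α → ℕ} (hs : ∀ n, {a | s a = n}.Finite) (k : ℕ)
    (w : α → Polynomial ℝ) :
    innerCoeff k (weightSeries s w) = weightSeries s fun a => (w a).coeff k := by
  ext n
  rw [coeff_innerCoeff, coeff_weightSeries, coeff_weightSeries,
    finsum_mem_eq_finite_toFinset_sum _ (hs n), finsum_mem_eq_finite_toFinset_sum _ (hs n),
    Polynomial.finsetSum_coeff]

/-! ### Elimination -/

/-- Elimination of the auxiliary series from the functional equations for the first three
Taylor coefficients of the generating function. -/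
theorem eliminate_field {K : Type*} [Field K] {x T S Y a b E₀ E₁ E₂ F₀ F₁ F₂ : K}
    (h1 : 1 - T ≠ 0) (h2 : 1 + T ≠ 0) (h3 : 1 - 2 * T ≠ 0) (hx : T * (1 - T) = x)
    (ha : a * (1 - 2 * T) = x) (hb : b * (1 - 2 * T) = a ^ 2) (hY : Y * (1 - T ^ 2) = 1 - S)
    (hE₀ : E₀ * (1 - T ^ 2) = x * S) (hE₁ : E₁ * (1 - T ^ 2) = x * S + 2 * T * a * E₀)
    (hE₂ : E₂ * (1 - T ^ 2) = 2 * T * a * E₁ + (2 * T * b + a ^ 2) * E₀)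
    (hF₀ : F₀ * (1 - (x * Y + E₀)) = x) (hF₁ : F₁ * (1 - (x * Y + E₀)) = x + E₁ * F₀)
    (hF₂ : F₂ * (1 - (x * Y + E₀)) = E₁ * F₁ + E₂ * F₀) :
    F₀ = x * (1 + T) ∧ F₁ * (1 - 2 * T) = x * ((1 + T) * (1 - 2 * T) + T * S * (1 - T)) ∧
      2 * F₂ * (1 - 2 * T) ^ 3 = x * (2 * T * S * (1 - T) * (1 - 2 * T) ^ 2
        + 4 * T ^ 3 * S * (1 - 2 * T) ^ 2 + 2 * T ^ 3 * S * (1 - T)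
        + 2 * (1 - 2 * T) * T ^ 2 * S * ((4 * T ^ 2 - 3 * T + 1) - (1 - T) ^ 3 * Y)) := by
  have h3' : 1 - T * 2 ≠ 0 := by rwa [mul_comm]
  have h12 : 1 - T ^ 2 = (1 - T) * (1 + T) := by ring
  rw [h12] at hY hE₀ hE₁ hE₂
  have h12' := mul_ne_zero h1 h2
  subst hx
  obtain rfl : a = T * (1 - T) / (1 - 2 * T) := by rw [eq_div_iff h3, ha]
  obtain rfl : b = (T * (1 - T)) ^ 2 / (1 - 2 * T) ^ 3 := by
    rw [eq_div_iff (pow_ne_zero 3 h3)]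
    rw [div_pow, eq_div_iff (pow_ne_zero 2 h3)] at hb
    linear_combination hb
  obtain rfl : E₀ = T * S / (1 + T) := by
    rw [← eq_div_iff h12'] at hE₀
    rw [hE₀]
    field_simp
  -- All dependence on `r` cancels here, which makes `F₀` independent of `r`.
  have hB : 1 - (T * (1 - T) * Y + T * S / (1 + T)) = 1 / (1 + T) := by
    field_simp
    linear_combination -T * hY
  rw [hB] at hF₀ hF₁ hF₂
  obtain rfl : F₀ = T * (1 - T) * (1 + T) := by
    rw [mul_one_div, div_eq_iff h2] at hF₀
    exact hF₀
  obtain rfl : E₁ = T * (1 - T) * S / ((1 - 2 * T) * (1 + T) ^ 2) := by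
    rw [← eq_div_iff h12'] at hE₁
    rw [hE₁]
    field_simp
    ring
  obtain rfl : E₂ = S * (2 * T ^ 3 / ((1 - 2 * T) * (1 + T) ^ 2) +
      T ^ 3 * (1 - T) / ((1 - 2 * T) ^ 3 * (1 + T) ^ 2) +
      4 * T ^ 5 / ((1 - 2 * T) ^ 2 * (1 + T) ^ 3)) := by
    rw [← eq_div_iff h12'] at hE₂
    rw [hE₂]
    field_simp
    ring
  rw [mul_one_div, div_eq_iff h2] at hF₁ hF₂
  have hF₁' : F₁ * (1 - 2 * T) = T * (1 - T) * ((1 + T) * (1 - 2 * T) + T * S * (1 - T)) := by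
    rw [hF₁]
    field_simp
  refine ⟨rfl, hF₁', ?_⟩
  rw [← eq_div_iff h3] at hF₁'
  rw [hF₂, hF₁']
  field_simp
  obtain rfl : S = 1 - Y * ((1 - T) * (1 + T)) := by rw [hY]; ring
  ring

/-- Transfers the identities through the fraction field. In the application `S` is `T ^ (2 * r)`,
`Y` is the sum of the `T ^ (2 * i)` with `i < r`, and `a`, `b` are the first- and second-order
coefficients of the marked tree series. -/
theorem eliminate_domain {A : Type*} [CommRing A] [IsDomain A]
    {x T S Y a b E₀ E₁ E₂ F₀ F₁ F₂ : A}
    (h1 : 1 - T ≠ 0) (h2 : 1 + T ≠ 0) (h3 : 1 - 2 * T ≠ 0) (hx : T * (1 - T) = x)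
    (ha : a * (1 - 2 * T) = x) (hb : b * (1 - 2 * T) = a ^ 2) (hY : Y * (1 - T ^ 2) = 1 - S)
    (hE₀ : E₀ * (1 - T ^ 2) = x * S) (hE₁ : E₁ * (1 - T ^ 2) = x * S + 2 * T * a * E₀)
    (hE₂ : E₂ * (1 - T ^ 2) = 2 * T * a * E₁ + (2 * T * b + a ^ 2) * E₀)
    (hF₀ : F₀ * (1 - (x * Y + E₀)) = x) (hF₁ : F₁ * (1 - (x * Y + E₀)) = x + E₁ * F₀)
    (hF₂ : F₂ * (1 - (x * Y + E₀)) = E₁ * F₁ + E₂ * F₀) :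
    F₀ = x * (1 + T) ∧ F₁ * (1 - 2 * T) = x * ((1 + T) * (1 - 2 * T) + T * S * (1 - T)) ∧
      2 * F₂ * (1 - 2 * T) ^ 3 = x * (2 * T * S * (1 - T) * (1 - 2 * T) ^ 2
        + 4 * T ^ 3 * S * (1 - 2 * T) ^ 2 + 2 * T ^ 3 * S * (1 - T)
        + 2 * (1 - 2 * T) * T ^ 2 * S * ((4 * T ^ 2 - 3 * T + 1) - (1 - T) ^ 3 * Y)) := by
  set f := algebraMap A (FractionRing A)
  have inj : Function.Injective f := IsFractionRing.injective A (FractionRing A)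
  have tr : ∀ {p q : A}, p = q → f p = f q := fun h => congrArg f h
  have tr0 : ∀ {p : A}, p ≠ 0 → f p ≠ 0 := fun h => (map_ne_zero_iff f inj).2 h
  replace h1 := tr0 h1
  replace h2 := tr0 h2
  replace h3 := tr0 h3
  replace hx := tr hx
  replace ha := tr ha
  replace hb := tr hb
  replace hY := tr hY
  replace hE₀ := tr hE₀
  replace hE₁ := tr hE₁
  replace hE₂ := tr hE₂
  replace hF₀ := tr hF₀
  replace hF₁ := tr hF₁
  replace hF₂ := tr hF₂
  simp only [map_mul, map_add, map_sub, map_pow, map_one, map_ofNat]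
    at h1 h2 h3 hx ha hb hY hE₀ hE₁ hE₂ hF₀ hF₁ hF₂
  have key := eliminate_field h1 h2 h3 hx ha hb hY hE₀ hE₁ hE₂ hF₀ hF₁ hF₂
  refine ⟨inj ?_, inj ?_, inj ?_⟩ <;>
    simp only [map_mul, map_add, map_sub, map_pow, map_one, map_ofNat]
  exacts [key.1, key.2.1, key.2.2]

namespace PlaneTree

theorem constantCoeff_treeSeries {R : Type*} [CommRing R] (v : R) :
    PowerSeries.constantCoeff (treeSeries v) = 0 := by
  rw [treeSeries_eq_mul_listSeries]
  simp

theorem innerCoeff_treeSeries_one (k : ℕ) :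
    innerCoeff k (treeSeries 1) = if k = 0 then treeSeries 1 else 0 := by
  rw [treeSeries, innerCoeff_weightSeries finite_size_eq]
  split_ifs with h
  · subst h
    exact weightSeries_congr _ fun t => by simp
  · ext n
    simp [coeff_weightSeries, Polynomial.coeff_one, h]

theorem treeSeries_one_eq_map :
    treeSeries (1 : Polynomial ℝ) = PowerSeries.map Polynomial.C (treeSeries 1) := by
  have h (k : ℕ) := (innerCoeff_treeSeries_one k).trans (innerCoeff_map_C k (treeSeries 1)).symm
  ext n k
  rw [← coeff_innerCoeff, h, coeff_innerCoeff]

theorem innerCoeff_zero_treeSeries :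
    innerCoeff 0 (treeSeries (1 + Polynomial.X)) = treeSeries 1 := by
  rw [treeSeries, innerCoeff_weightSeries finite_size_eq]
  exact weightSeries_congr _ fun t => by simp [Polynomial.coeff_one_add_X_pow]

/-- The functional equations for the marked tree series, the surviving branches and the whole trees
are each compared at orders `0`, `1`, `2` in `v - 1`; the resulting equations are solved by
`eliminate_domain`. -/
theorem ancestorSeries_coeffs (r : ℕ) {T F₀ F₁ F₂ : PowerSeries ℝ} (hT : treeSeries 1 = T)
    (hF₀ : innerCoeff 0 (ancestorSeries (1 + Polynomial.X) r) = F₀)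
    (hF₁ : innerCoeff 1 (ancestorSeries (1 + Polynomial.X) r) = F₁)
    (hF₂ : innerCoeff 2 (ancestorSeries (1 + Polynomial.X) r) = F₂) :
    F₀ = PowerSeries.X * (1 + T) ∧
    F₁ * (1 - 2 * T) =
      PowerSeries.X * ((1 + T) * (1 - 2 * T) + T * T ^ (2 * r) * (1 - T)) ∧
    2 * F₂ * (1 - 2 * T) ^ 3 =
      PowerSeries.X * (2 * T * T ^ (2 * r) * (1 - T) * (1 - 2 * T) ^ 2
        + 4 * T ^ 3 * T ^ (2 * r) * (1 - 2 * T) ^ 2 + 2 * T ^ 3 * T ^ (2 * r) * (1 - T)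
        + 2 * (1 - 2 * T) * T ^ 2 * T ^ (2 * r) *
          ((4 * T ^ 2 - 3 * T + 1) - (1 - T) ^ 3 * ∑ i ∈ Finset.range r, T ^ (2 * i))) := by
  set P := treeSeries (1 + Polynomial.X : Polynomial ℝ) with hP
  set E := weightSeries size (keptWeight (1 + Polynomial.X : Polynomial ℝ) (2 * r) 0) with hE
  set F := ancestorSeries (1 + Polynomial.X : Polynomial ℝ) r with hF
  have hT0 : PowerSeries.constantCoeff T = 0 := hT ▸ constantCoeff_treeSeries _
  have hone (k : ℕ) : innerCoeff k 1 = if k = 0 then 1 else 0 := by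
    simpa using innerCoeff_map_C k 1
  have hXmap : (PowerSeries.X : PowerSeries (Polynomial ℝ)) =
    PowerSeries.map Polynomial.C PowerSeries.X := by simp
  have hX (k : ℕ) : innerCoeff k PowerSeries.X = if k = 0 then PowerSeries.X else 0 := by
    rw [hXmap, innerCoeff_map_C]
  have hp0 : innerCoeff 0 P = T := by rw [hP, innerCoeff_zero_treeSeries, hT]
  have eP := treeSeries_mul (1 + Polynomial.X : Polynomial ℝ)
  have eE := weightSeries_keptWeight (1 + Polynomial.X : Polynomial ℝ) (2 * r)
  have eF := ancestorSeries_mul (1 + Polynomial.X : Polynomial ℝ) r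
  rw [weightSeries_branchWeight, ← hE, ← hF, treeSeries_one_eq_map, hT] at eF
  rw [← hE, ← hP, treeSeries_one_eq_map, hT] at eE
  rw [← hP] at eP
  have hS (k : ℕ) : innerCoeff k (PowerSeries.X * PowerSeries.map Polynomial.C T ^ (2 * r)) =
      if k = 0 then PowerSeries.X * T ^ (2 * r) else 0 := by
    rw [hXmap, ← map_pow, ← map_mul, innerCoeff_map_C]
  have hY (k : ℕ) : innerCoeff k
      (∑ i ∈ Finset.range r, PowerSeries.X * PowerSeries.map Polynomial.C T ^ (2 * i)) =
      if k = 0 then PowerSeries.X * ∑ i ∈ Finset.range r, T ^ (2 * i) else 0 := by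
    rw [hXmap]
    simp only [← map_pow, ← map_mul, ← map_sum]
    rw [innerCoeff_map_C, Finset.mul_sum]
  have eP0 := congrArg (innerCoeff 0) eP
  have eP1 := congrArg (innerCoeff 1) eP
  have eP2 := congrArg (innerCoeff 2) eP
  have eE0 := congrArg (innerCoeff 0) eE
  have eE1 := congrArg (innerCoeff 1) eE
  have eE2 := congrArg (innerCoeff 2) eE
  have eF0 := congrArg (innerCoeff 0) eF
  have eF1 := congrArg (innerCoeff 1) eF
  have eF2 := congrArg (innerCoeff 2) eF
  simp only [innerCoeff_zero_mul, innerCoeff_one_mul, innerCoeff_two_mul, map_sub, map_add, hone,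
    hX, innerCoeff_C, hF₀, hF₁, hF₂, hp0, hS, hY, pow_two P, 
    Polynomial.coeff_X, if_true, one_ne_zero, two_ne_zero, if_false,
    OfNat.one_ne_ofNat, map_zero, map_one, zero_add, add_zero, mul_zero, zero_mul,
    mul_one, one_mul] at eP0 eP1 eP2 eE0 eE1 eE2 eF0 eF1 eF2
  refine eliminate_domain (a := innerCoeff 1 P) (b := innerCoeff 2 P) (E₀ := innerCoeff 0 E)
    (E₁ := innerCoeff 1 E) (E₂ := innerCoeff 2 E) ?_ ?_ ?_ eP0 ?_ ?_ ?_ ?_ ?_ ?_ ?_ ?_ ?_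
  -- The three divisors have constant term `1`, since `T` has constant term `0`.
  · exact fun h => by simpa [hT0] using congrArg PowerSeries.constantCoeff h
  · exact fun h => by simpa [hT0] using congrArg PowerSeries.constantCoeff h
  · exact fun h => by simpa [hT0] using congrArg PowerSeries.constantCoeff h
  · linear_combination eP1
  · linear_combination eP2
  · have := geom_sum_mul (T ^ 2) r
    simp only [← pow_mul] at this
    linear_combination -this
  · linear_combination eE0
  · linear_combination eE1
  · linear_combination eE2
  · linear_combination eF0
  · linear_combination eF1
  · linear_combination eF2

/-! ### Expectation and variance as quotients of coefficients -/

theorem integral_uniformCS (n : ℕ) (f : PlaneTree → ℝ) :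
    ∫ t, f t ∂(uniformCS n) =
      (∑ t ∈ (finite_catalanStanley n).toFinset, f t) /
        (finite_catalanStanley n).toFinset.card := by
  have hS : catalanStanley n = ((finite_catalanStanley n).toFinset : Set PlaneTree) := by simp
  rw [uniformCS, uniformOn, ProbabilityTheory.cond, integral_smul_measure]
  conv_lhs => rw [hS]
  have hf (s : Finset PlaneTree) : IntegrableOn f s Measure.count := by
    rw [← (s : Set PlaneTree).biUnion_of_singleton]
    exact integrableOn_finset_iUnion.2 fun t _ => 
      integrableOn_singleton (hx := by rw [Measure.count_singleton]; exact ENNReal.one_lt_top)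
  rw [setIntegral_finset _ (hf _), Measure.count_apply_finset]
  simp [Measure.real, div_eq_inv_mul]

theorem coeff_innerCoeff_ancestorSeries (k r n : ℕ) :
    (innerCoeff k (ancestorSeries (1 + Polynomial.X) r)).coeff n =
      ∑ t ∈ (finite_catalanStanley n).toFinset, ((reduce^[r] t).size.choose k : ℝ) := by
  classical
  rw [ancestorSeries, innerCoeff_weightSeries finite_size_eq, coeff_weightSeries,
    finsum_mem_eq_finite_toFinset_sum _ (finite_size_eq n)]
  have : (finite_catalanStanley n).toFinset =
      (finite_size_eq n).toFinset.filter IsCatalanStanley := by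
    ext t
    simp [catalanStanley, and_comm]
  rw [this, Finset.sum_filter]
  refine Finset.sum_congr rfl fun t _ => ?_
  rw [ancestorWeight]
  split_ifs <;> simp [Polynomial.coeff_one_add_X_pow]

theorem expectation_ancestorSize (r n : ℕ) :
    ∫ t, ancestorSize r t ∂(uniformCS n) =
      (innerCoeff 1 (ancestorSeries (1 + Polynomial.X) r)).coeff n /
        (innerCoeff 0 (ancestorSeries (1 + Polynomial.X) r)).coeff n := by
  rw [integral_uniformCS, coeff_innerCoeff_ancestorSeries, coeff_innerCoeff_ancestorSeries]
  simp [ancestorSize]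

theorem variance_ancestorSize {r n : ℕ} (hn : 1 ≤ n) :
    variance (ancestorSize r) (uniformCS n) =
      2 * (innerCoeff 2 (ancestorSeries (1 + Polynomial.X) r)).coeff n /
        (innerCoeff 0 (ancestorSeries (1 + Polynomial.X) r)).coeff n +
      (∫ t, ancestorSize r t ∂(uniformCS n)) - (∫ t, ancestorSize r t ∂(uniformCS n)) ^ 2 := by
  have hc : ((finite_catalanStanley n).toFinset.card : ℝ) ≠ 0 := by
    rw [Nat.cast_ne_zero, Finset.card_ne_zero]
    simpa using catalanStanley_nonempty hn
  rw [variance_eq_integral Measurable.of_discrete.aemeasurable, integral_uniformCS]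
  simp only [coeff_innerCoeff_ancestorSeries, integral_uniformCS n (ancestorSize r)]
  have h2 (x : PlaneTree) : ((reduce^[r] x).size.choose 2 : ℝ) =
      (ancestorSize r x ^ 2 - ancestorSize r x) / 2 := by
    rw [Nat.cast_choose_two, ancestorSize]
    ring
  simp only [h2, ← Finset.sum_div, sub_sq, Finset.sum_add_distrib, Finset.sum_sub_distrib,
    ← Finset.mul_sum, ← Finset.sum_mul, Finset.sum_const, nsmul_eq_mul, Nat.choose_zero_right,
    Nat.cast_one, mul_one]
  field_simp
  ring

/-! ### Coefficients of powers of `√(1 - 4 X)` -/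

/-- The number of plane trees of size `m + 1` (a Catalan number). -/
noncomputable def treeCount (m : ℕ) : ℝ := (treeSeries (1 : ℝ)).coeff (m + 1)

/-- The power series `√(1 - 4 X)`. -/
noncomputable def sqrtSeries : PowerSeries ℝ := 1 - 2 * treeSeries 1

theorem sqrtSeries_sq : sqrtSeries ^ 2 = 1 - 4 * PowerSeries.X := by
  have := treeSeries_mul (1 : ℝ)
  rw [map_one, mul_one] at this
  rw [sqrtSeries]
  linear_combination -4 * this

theorem constantCoeff_sqrtSeries : PowerSeries.constantCoeff sqrtSeries = 1 := by
  simp [sqrtSeries, constantCoeff_treeSeries]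

theorem sqrtSeries_mul_inv : sqrtSeries * sqrtSeries⁻¹ = 1 :=
  PowerSeries.mul_inv_cancel _ (by simp [constantCoeff_sqrtSeries])

theorem sqrtSeries_ne_zero : sqrtSeries ≠ 0 := fun h => by
  simpa [h] using constantCoeff_sqrtSeries

local notation "D" => PowerSeries.derivative ℝ

theorem sqrtSeries_mul_derivative : sqrtSeries * D sqrtSeries = -2 := by
  have h1 : sqrtSeries * sqrtSeries = 1 - (4 : ℝ) • PowerSeries.X := by
    rw [← pow_two, sqrtSeries_sq, PowerSeries.smul_eq_C_mul, map_ofNat]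
  have h := congrArg (D) h1
  rw [Derivation.leibniz, map_sub, Derivation.map_smul, PowerSeries.derivative_X, Derivation.map_one_eq_zero,
    PowerSeries.smul_eq_C_mul, map_ofNat, smul_eq_mul] at h
  have h2 : PowerSeries.C (2⁻¹ : ℝ) * 2 = 1 := by
    rw [← map_ofNat PowerSeries.C 2, ← map_mul]
    norm_num
  linear_combination PowerSeries.C (2⁻¹ : ℝ) * h - (sqrtSeries * D sqrtSeries + 2) * h2

theorem derivative_sqrtSeries : D sqrtSeries = -2 * sqrtSeries⁻¹ := by
  linear_combination sqrtSeries⁻¹ * sqrtSeries_mul_derivative - D sqrtSeries * sqrtSeries_mul_inv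

theorem derivative_sqrtSeries_inv : D sqrtSeries⁻¹ = 2 * sqrtSeries⁻¹ ^ 3 := by
  have h := congrArg (D) sqrtSeries_mul_inv
  rw [Derivation.leibniz, derivative_sqrtSeries] at h
  simp only [smul_eq_mul, Derivation.map_one_eq_zero] at h
  linear_combination sqrtSeries⁻¹ * h - D sqrtSeries⁻¹ * sqrtSeries_mul_inv

theorem derivative_sqrtSeries_pow (k : ℕ) :
    D (sqrtSeries ^ (k + 2)) = PowerSeries.C (-2 * (k + 2) : ℝ) * sqrtSeries ^ k := by
  have hC : (PowerSeries.C (-2 * (k + 2) : ℝ)) = -2 * (k + 2) := by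
    simp only [map_mul, map_neg, map_add, map_natCast, map_ofNat]
  rw [Derivation.leibniz_pow, derivative_sqrtSeries, hC, nsmul_eq_mul, smul_eq_mul,
    show k + 2 - 1 = k + 1 from rfl]
  push_cast
  linear_combination (-2 * (k + 2) * sqrtSeries ^ k) * sqrtSeries_mul_inv

/-- Raising the exponent by two gains a factor of order `1 / m`; this replaces singularity analysis
below. -/
theorem coeff_sqrtSeries_pow_succ (k m : ℕ) :
    (sqrtSeries ^ (k + 2)).coeff (m + 1) * (m + 1) =
      -2 * (k + 2) * (sqrtSeries ^ k).coeff m := by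
  rw [← PowerSeries.coeff_derivative, derivative_sqrtSeries_pow, PowerSeries.coeff_C_mul]

theorem coeff_succ_sqrtSeries (m : ℕ) : sqrtSeries.coeff (m + 1) = -2 * treeCount m := by
  rw [sqrtSeries, treeCount, ← map_ofNat PowerSeries.C 2, map_sub, PowerSeries.coeff_C_mul]
  simp [PowerSeries.coeff_one]

theorem coeff_sqrtSeries_inv (m : ℕ) : sqrtSeries⁻¹.coeff m = (m + 1) * treeCount m := by
  have h := congrArg (PowerSeries.coeff m) derivative_sqrtSeries
  rw [PowerSeries.coeff_derivative, coeff_succ_sqrtSeries,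
    show (-2 : PowerSeries ℝ) = PowerSeries.C (-2) by rw [map_neg, map_ofNat], PowerSeries.coeff_C_mul] at h
  linear_combination h / 2

theorem treeCount_zero : treeCount 0 = 1 := by
  have := coeff_sqrtSeries_inv 0
  simpa [constantCoeff_sqrtSeries] using this.symm

/-- The Catalan recurrence, read off from the differential equation `(1 - 4 X) s' = -2 s`. -/
theorem treeCount_succ (m : ℕ) : (m + 2) * treeCount (m + 1) = (4 * m + 2) * treeCount m := by
  have h : (1 - 4 * PowerSeries.X) * D sqrtSeries = -2 * sqrtSeries := by
    rw [← sqrtSeries_sq, derivative_sqrtSeries]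
    linear_combination -2 * sqrtSeries * sqrtSeries_mul_inv
  have h' : D sqrtSeries - PowerSeries.X * (PowerSeries.C (4 : ℝ) * D sqrtSeries) =
      PowerSeries.C (-2 : ℝ) * sqrtSeries := by
    rw [map_neg, map_ofNat, map_ofNat]
    linear_combination h
  have := congrArg (PowerSeries.coeff (m + 1)) h'
  rw [map_sub, PowerSeries.coeff_succ_X_mul, PowerSeries.coeff_C_mul, PowerSeries.coeff_C_mul,
    PowerSeries.coeff_derivative, PowerSeries.coeff_derivative, coeff_succ_sqrtSeries,
    coeff_succ_sqrtSeries] at this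
  push_cast at this
  linear_combination -this / 2

theorem one_le_treeCount (m : ℕ) : 1 ≤ treeCount m := by
  induction m with
  | zero => rw [treeCount_zero]
  | succ m ih =>
    have := treeCount_succ m
    have hm : (0 : ℝ) ≤ m := m.cast_nonneg
    nlinarith

theorem treeCount_le_succ (m : ℕ) : treeCount m ≤ treeCount (m + 1) := by
  have := treeCount_succ m
  have h1 := one_le_treeCount m
  have hm : (0 : ℝ) ≤ m := m.cast_nonneg
  nlinarith

theorem coeff_sqrtSeries_inv_succ (m : ℕ) :
    sqrtSeries⁻¹.coeff (m + 1) = (4 * m + 2) * treeCount m := by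
  rw [coeff_sqrtSeries_inv, ← treeCount_succ]
  push_cast
  ring

theorem coeff_sqrtSeries_inv_cube_succ (m : ℕ) :
    (sqrtSeries⁻¹ ^ 3).coeff (m + 1) = (2 * m + 3) * (4 * m + 2) * treeCount m := by
  have h := congrArg (PowerSeries.coeff (m + 1)) derivative_sqrtSeries_inv
  rw [PowerSeries.coeff_derivative, coeff_sqrtSeries_inv_succ,
    show (2 : PowerSeries ℝ) = PowerSeries.C 2 by rw [map_ofNat], PowerSeries.coeff_C_mul] at h
  have := treeCount_succ m
  push_cast at h
  linear_combination -h / 2 + (2 * m + 3) * this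

theorem coeff_sqrtSeries_inv_sq (m : ℕ) : (sqrtSeries⁻¹ ^ 2).coeff m = 4 ^ m := by
  have h : sqrtSeries⁻¹ ^ 2 = 1 + PowerSeries.X * (PowerSeries.C (4 : ℝ) * sqrtSeries⁻¹ ^ 2) := by
    have h1 := sqrtSeries_mul_inv
    have h2 := sqrtSeries_sq
    rw [map_ofNat]
    linear_combination (-sqrtSeries⁻¹ ^ 2) * h2 + (sqrtSeries * sqrtSeries⁻¹ + 1) * h1
  induction m with
  | zero => simp [constantCoeff_sqrtSeries]
  | succ m ih =>
    rw [h, map_add, PowerSeries.coeff_succ_X_mul, PowerSeries.coeff_C_mul, ih]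
    simp [PowerSeries.coeff_one]
    ring

theorem coeff_sqrtSeries_cube {m : ℕ} (hm : 1 ≤ m) :
    (sqrtSeries ^ 3).coeff (m + 1) = 6 / (2 * m - 1) * treeCount m := by
  obtain ⟨m, rfl⟩ := Nat.exists_eq_add_of_le' hm
  have h := coeff_sqrtSeries_pow_succ 1 (m + 1)
  rw [pow_one, coeff_succ_sqrtSeries] at h
  have h2 := treeCount_succ m
  have hm : (0 : ℝ) ≤ m := m.cast_nonneg
  push_cast at h ⊢
  have h3 : (2 * ((m : ℝ) + 1) - 1) ≠ 0 := by linarith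
  have h4 : ((m : ℝ) + 1 + 1) ≠ 0 := by linarith
  rw [div_mul_eq_mul_div, eq_div_iff h3]
  apply mul_right_cancel₀ h4
  linear_combination (2 * ((m : ℝ) + 1) - 1) * h - 6 * h2

/-! ### Bounds for the coefficients of high powers -/

/-- The coefficient of `X ^ (m + 1)` is at most of order `treeCount m / (m + 1) ^ j`. -/
def CoeffBound (j : ℕ) (G : PowerSeries ℝ) : Prop :=
  ∃ C : ℝ, ∀ m : ℕ, |G.coeff (m + 1)| ≤ C * treeCount m / (m + 1) ^ j

theorem CoeffBound.add {j : ℕ} {G H : PowerSeries ℝ} (hG : CoeffBound j G)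
    (hH : CoeffBound j H) : CoeffBound j (G + H) := by
  obtain ⟨A, hA⟩ := hG
  obtain ⟨B, hB⟩ := hH
  refine ⟨A + B, fun m => ?_⟩
  rw [map_add, add_mul, add_div]
  exact (abs_add_le _ _).trans (add_le_add (hA m) (hB m))

theorem CoeffBound.const_mul {j : ℕ} {G : PowerSeries ℝ} (hG : CoeffBound j G) (a : ℝ) :
    CoeffBound j (PowerSeries.C a * G) := by
  obtain ⟨A, hA⟩ := hG
  refine ⟨|a| * A, fun m => ?_⟩
  rw [PowerSeries.coeff_C_mul, abs_mul, mul_assoc, mul_div_assoc]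
  exact mul_le_mul_of_nonneg_left (hA m) (abs_nonneg a)

theorem CoeffBound.of_succ {j : ℕ} {G : PowerSeries ℝ} (hG : CoeffBound (j + 1) G) :
    CoeffBound j G := by
  obtain ⟨A, hA⟩ := hG
  -- The bound at `m = 0` already forces the constant to be nonnegative.
  have hA0 : 0 ≤ A := by
    have := (abs_nonneg _).trans (hA 0)
    simpa [treeCount_zero] using this
  refine ⟨A, fun m => (hA m).trans ?_⟩
  have := zero_le_one.trans (one_le_treeCount m)
  exact div_le_div_of_nonneg_left (by positivity) (by positivity)
    (pow_le_pow_right₀ (by linarith [(m.cast_nonneg : (0 : ℝ) ≤ m)]) j.le_succ)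

theorem CoeffBound.pow_add_two {j k : ℕ} (h : CoeffBound j (sqrtSeries ^ k)) :
    CoeffBound (j + 1) (sqrtSeries ^ (k + 2)) := by
  obtain ⟨A, hA⟩ := h
  have hA0 : 0 ≤ A := by
    have := (abs_nonneg _).trans (hA 0)
    simpa [treeCount_zero] using this
  -- The first entry covers `m = 0`. In the second, `2 * (k + 2)` comes from differentiating, and `2
  -- ^ j` pays for the shift from `m + 1` to `m + 2` in the denominator.
  refine ⟨max |(sqrtSeries ^ (k + 2)).coeff 1| (2 ^ (j + 1) * (k + 2) * A), fun m => ?_⟩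
  cases m with
  | zero => simp [treeCount_zero]
  | succ m =>
    have hm : (0 : ℝ) ≤ m := m.cast_nonneg
    have h1 : (sqrtSeries ^ (k + 2)).coeff (m + 1 + 1) =
        -2 * (k + 2) * (sqrtSeries ^ k).coeff (m + 1) / (m + 2) := by
      rw [eq_div_iff (by linarith), ← coeff_sqrtSeries_pow_succ]
      push_cast
      ring
    have h2 : (0 : ℝ) < treeCount m := zero_lt_one.trans_le (one_le_treeCount m)
    have h3 := treeCount_le_succ m
    have h4 : ((m : ℝ) + 2) ^ j ≤ 2 ^ j * (m + 1) ^ j := by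
      rw [← mul_pow]
      exact pow_le_pow_left₀ (by linarith) (by linarith) j
    rw [h1, abs_div, abs_mul, abs_mul, abs_of_pos (by linarith : (0 : ℝ) < m + 2),
      abs_of_pos (by positivity : (0 : ℝ) < k + 2)]
    calc |(-2 : ℝ)| * (k + 2) * |(sqrtSeries ^ k).coeff (m + 1)| / (m + 2)
        ≤ 2 * (k + 2) * (A * treeCount m / (m + 1) ^ j) / (m + 2) := by
          rw [abs_neg, abs_two]
          gcongr
          exact hA m
      _ ≤ 2 * (k + 2) * (A * treeCount (m + 1) * (2 ^ j / (m + 2) ^ j)) / (m + 2) := by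
          rw [div_eq_mul_inv (A * treeCount m)]
          have := h2.le.trans h3
          gcongr
          rw [inv_eq_one_div, div_le_div_iff₀ (by positivity) (by positivity), one_mul]
          exact h4
      _ = 2 ^ (j + 1) * (k + 2) * A * treeCount (m + 1) / (m + 2) ^ (j + 1) := by
          rw [pow_succ, pow_succ]
          field_simp
      _ ≤ _ := by
          push_cast
          rw [show (m : ℝ) + 1 + 1 = m + 2 by ring]
          have := h2.trans_le h3
          gcongr
          exact le_max_right _ _

theorem coeffBound_zero_pow (k : ℕ) : CoeffBound 0 (sqrtSeries ^ (k + 1)) := by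
  induction k using Nat.twoStepInduction with
  | zero =>
    refine ⟨2, fun m => ?_⟩
    have := one_le_treeCount m
    rw [zero_add, pow_one, coeff_succ_sqrtSeries, abs_mul, abs_neg, abs_two,
      abs_of_pos (by linarith)]
    simp
  | one =>
    refine ⟨4, fun m => ?_⟩
    have := one_le_treeCount m
    rw [sqrtSeries_sq, ← map_ofNat PowerSeries.C 4, map_sub, PowerSeries.coeff_C_mul,
      PowerSeries.coeff_X, PowerSeries.coeff_one]
    split_ifs with h1 h2 <;> norm_num at * <;> linarith
  | more k h _ => exact h.pow_add_two.of_succ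

theorem coeffBound_pow {j k : ℕ} (h : 2 * j + 1 ≤ k) : CoeffBound j (sqrtSeries ^ k) := by
  induction j generalizing k with
  | zero =>
    obtain ⟨k, rfl⟩ := Nat.exists_eq_add_of_le' h
    exact coeffBound_zero_pow k
  | succ j ih =>
    obtain ⟨k, rfl⟩ := Nat.exists_eq_add_of_le' (show 2 ≤ k by omega)
    exact (ih (by omega)).pow_add_two

/-- Controls the remainder after a polynomial in `sqrtSeries` has been truncated. -/
theorem coeffBound_pow_mul_aeval {j k : ℕ} (h : 2 * j + 1 ≤ k) (V : Polynomial ℝ) :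
    CoeffBound j (sqrtSeries ^ k * Polynomial.aeval sqrtSeries V) := by
  induction V using Polynomial.induction_on' with
  | add p q hp hq => simpa [mul_add] using hp.add hq
  | monomial i a =>
    have := (coeffBound_pow (h.trans (Nat.le_add_right k i))).const_mul a
    rw [Polynomial.aeval_monomial]
    convert this using 1
    rw [pow_add, PowerSeries.algebraMap_apply, Algebra.algebraMap_self, RingHom.id_apply]
    ring

/-! ### Wallis' product and the half-integer powers -/

/-- The central ratio `4 ^ m / ((m + 1) * treeCount m)`, which grows like `√(π m)`. -/
noncomputable def wallisRatio (m : ℕ) : ℝ := 4 ^ m / ((m + 1) * treeCount m)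

theorem wallisRatio_pos (m : ℕ) : 0 < wallisRatio m := by
  have := zero_lt_one.trans_le (one_le_treeCount m)
  unfold wallisRatio
  positivity

theorem wallisRatio_succ (m : ℕ) :
    wallisRatio (m + 1) = (2 * m + 2) / (2 * m + 1) * wallisRatio m := by
  have h1 := zero_lt_one.trans_le (one_le_treeCount m)
  have h2 := zero_lt_one.trans_le (one_le_treeCount (m + 1))
  have h3 := treeCount_succ m
  have hm : (0 : ℝ) ≤ m := m.cast_nonneg
  have h4 : treeCount (m + 1) = (4 * m + 2) * treeCount m / (m + 2) := by
    rw [eq_div_iff (by positivity)]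
    linear_combination h3
  unfold wallisRatio
  rw [h4]
  push_cast
  field_simp
  ring

theorem wallisRatio_sq (m : ℕ) : wallisRatio m ^ 2 = Real.Wallis.W m * (2 * m + 1) := by
  induction m with
  | zero => simp [wallisRatio, treeCount_zero, Real.Wallis.W]
  | succ m ih =>
    rw [wallisRatio_succ, mul_pow, ih, Real.Wallis.W_succ]
    push_cast
    field_simp
    ring

theorem tendsto_wallisRatio_sq_div {f : ℕ → ℝ}
    (hf : Tendsto (fun m : ℕ => (2 * m + 1) / f m) atTop (𝓝 2)) :
    Tendsto (fun m => wallisRatio m ^ 2 / f m) atTop (𝓝 Real.pi) := by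
  have := Real.Wallis.tendsto_W_nhds_pi_div_two.mul hf
  rw [div_mul_cancel₀ _ two_ne_zero] at this
  refine this.congr fun m => ?_
  rw [wallisRatio_sq, mul_div_assoc]

/-- The quotient by `m + 1 / 4` decreases to `π`. With the shift `1 / 4`, the two sides of the
cross-multiplied monotonicity inequality differ only by a constant. -/
theorem le_wallisRatio_sq (m : ℕ) : Real.pi * (m + 1 / 4) ≤ wallisRatio m ^ 2 := by
  have hanti : Antitone fun m : ℕ => wallisRatio m ^ 2 / ((m : ℝ) + 1 / 4) := by
    refine antitone_nat_of_succ_le fun m => ?_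
    have h := pow_pos (wallisRatio_pos m) 2
    rw [wallisRatio_succ, mul_pow, mul_comm, mul_div_assoc, div_eq_mul_inv (wallisRatio m ^ 2)]
    refine mul_le_mul_of_nonneg_left ?_ h.le
    rw [div_pow, div_div, inv_eq_one_div, div_le_div_iff₀ (by positivity) (by positivity)]
    push_cast
    nlinarith
  have hlim : Tendsto (fun m : ℕ => (2 * (m : ℝ) + 1) / (m + 1 / 4)) atTop (𝓝 2) := by
    have h1 : Tendsto (fun m : ℕ => (m : ℝ) + 1 / 4) atTop atTop :=
      tendsto_atTop_add_const_right _ _ tendsto_natCast_atTop_atTop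
    have h2 := ((tendsto_const_nhds (x := (1 / 2 : ℝ))).div_atTop h1).const_add 2
    rw [add_zero] at h2
    refine h2.congr fun m => ?_
    field_simp
    ring
  have := hanti.le_of_tendsto (tendsto_wallisRatio_sq_div hlim) m
  rwa [le_div_iff₀ (by positivity)] at this

/-- The extra `1 / (4 * (m + 1))` reverses the monotonicity: this quotient increases to `π`. -/
theorem wallisRatio_sq_le (m : ℕ) :
    wallisRatio m ^ 2 ≤ Real.pi * (m + 1 / 4 + 1 / (4 * (m + 1))) := by
  have hmono : Monotone fun m : ℕ =>
      wallisRatio m ^ 2 / ((m : ℝ) + 1 / 4 + 1 / (4 * (m + 1))) := by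
    refine monotone_nat_of_le_succ fun m => ?_
    have h := pow_pos (wallisRatio_pos m) 2
    rw [wallisRatio_succ, mul_pow, mul_comm _ (wallisRatio m ^ 2), mul_div_assoc,
      div_eq_mul_inv (wallisRatio m ^ 2)]
    refine mul_le_mul_of_nonneg_left ?_ h.le
    rw [div_pow, div_div, inv_eq_one_div, div_le_div_iff₀ (by positivity) (by positivity)]
    push_cast
    field_simp
    rw [← sub_nonneg]
    ring_nf
    positivity
  have hlim : Tendsto (fun m : ℕ => (2 * (m : ℝ) + 1) / (m + 1 / 4 + 1 / (4 * (m + 1)))) atTop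
      (𝓝 2) := by
    have h1 : Tendsto (fun m : ℕ => (m : ℝ) + 1) atTop atTop :=
      tendsto_atTop_add_const_right _ _ tendsto_natCast_atTop_atTop
    have h0 := tendsto_inv_atTop_zero.comp h1
    have h2 : Tendsto (fun m : ℕ => (2 - ((m : ℝ) + 1)⁻¹) /
        (1 - 3 / 4 * ((m : ℝ) + 1)⁻¹ + 1 / 4 * ((m : ℝ) + 1)⁻¹ * ((m : ℝ) + 1)⁻¹)) atTop
        (𝓝 ((2 - 0) / (1 - 3 / 4 * 0 + 1 / 4 * 0 * 0))) :=
      (h0.const_sub 2).div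
        (((h0.const_mul (3 / 4)).const_sub 1).add ((h0.const_mul (1 / 4)).mul h0)) (by norm_num)
    norm_num at h2
    refine (h2.congr fun m => ?_)
    have hm : (0 : ℝ) ≤ m := m.cast_nonneg
    set x := ((m : ℝ) + 1)⁻¹ with hx
    have hx1 : x * (m + 1) = 1 := inv_mul_cancel₀ (by positivity)
    have h3 : 1 - 3 / 4 * x + 1 / 4 * x * x ≠ 0 := by nlinarith [sq_nonneg (x - 3 / 2)]
    rw [div_eq_div_iff h3 (by positivity), hx]
    field_simp
    ring
  have := hmono.ge_of_tendsto (tendsto_wallisRatio_sq_div hlim) m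
  rwa [div_le_iff₀ (by positivity)] at this

/-- With `N = m + 2`, the quotient is `4 (N - 1)` times the Wallis ratio, which is close to `√π √(N
- 7/4)`. Expanding the root as `√N - 7 / (8 √N)` produces the coefficient `15/8 = 1 + 7/8`. -/
theorem abs_four_pow_div_treeCount_sub_le (m : ℕ) :
    |4 ^ (m + 1) / treeCount m -
      4 * √Real.pi * (((m : ℝ) + 2) * √((m : ℝ) + 2) - 15 / 8 * √((m : ℝ) + 2))| ≤
      16 * √Real.pi := by
  have hm : (0 : ℝ) ≤ m := m.cast_nonneg
  have hκ := zero_lt_one.trans_le (one_le_treeCount m)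
  have hπ : 0 < √Real.pi := Real.sqrt_pos.2 Real.pi_pos
  have hπ2 := Real.sq_sqrt Real.pi_pos.le
  set N : ℝ := m + 2 with hN
  have hmN : (m : ℝ) = N - 2 := by rw [hN]; ring
  have hN2 : 2 ≤ N := by linarith
  set y := √N with hy
  have hy2 : y ^ 2 = N := Real.sq_sqrt (by linarith)
  have hy1 : 1 ≤ y := Real.one_le_sqrt.2 (by linarith)
  obtain ⟨s, hs⟩ : ∃ s, wallisRatio m = √Real.pi * s :=
    ⟨wallisRatio m / √Real.pi, by field_simp⟩
  have hs0 : 0 < s := by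
    have := wallisRatio_pos m
    rw [hs] at this
    exact (mul_pos_iff_of_pos_left hπ).1 this
  have hlo := le_wallisRatio_sq m
  have hup := wallisRatio_sq_le m
  rw [hs, mul_pow, hπ2] at hlo hup
  replace hlo := le_of_mul_le_mul_left hlo Real.pi_pos
  replace hup := le_of_mul_le_mul_left hup Real.pi_pos
  have e1 : (4 : ℝ) ^ (m + 1) / treeCount m = 4 * √Real.pi * ((N - 1) * s) := by
    have : (4 : ℝ) ^ (m + 1) / treeCount m = 4 * (m + 1) * wallisRatio m := by
      unfold wallisRatio
      field_simp
      ring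
    rw [this, hs, hmN]
    ring
  rw [e1, ← mul_sub, abs_mul, abs_of_pos (by positivity : 0 < 4 * √Real.pi)]
  suffices |(N - 1) * s - (N * y - 15 / 8 * y)| ≤ 4 by nlinarith
  -- The first two terms of `√(N - 7/4)` at infinity, so that `p ^ 2 = N - 7/4 + 49 / (64 N)`.
  obtain ⟨p, hp⟩ : ∃ p, p = y - 7 / (8 * y) := ⟨_, rfl⟩
  have hp1 : 1 / 2 ≤ p := by
    have : 7 / (8 * y) ≤ y - 1 / 2 := by
      rw [div_le_iff₀ (by positivity)]
      nlinarith [sq_nonneg (y - 1)]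
    linarith
  have hd : (s - p) * (s + p) = s ^ 2 - (N - 7 / 4) - 49 / (64 * N) := by
    rw [hp, ← hy2]
    field_simp
    ring
  have h5 : |s - p| * (N - 1) ≤ 3 := by
    have hN1 : 0 < N - 1 := by linarith
    have h8 : |(s - p) * (s + p)| ≤ 1 / (N - 1) := by
      have h9 : 49 / (64 * N) ≤ 1 / (N - 1) := by
        rw [div_le_div_iff₀ (by positivity) hN1]
        linarith
      have h10 : 1 / (4 * (N - 1)) ≤ 1 / (N - 1) :=
        one_div_le_one_div_of_le hN1 (by linarith)
      have h11 : 0 ≤ 49 / (64 * N) := by positivity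
      rw [hmN] at hlo hup
      rw [show N - 2 + 1 = N - 1 by ring] at hup
      rw [hd, abs_le]
      constructor <;> linarith
    rw [abs_mul, abs_of_pos (by linarith : 0 < s + p)] at h8
    rw [le_div_iff₀ hN1] at h8
    nlinarith [mul_nonneg (abs_nonneg (s - p)) hN1.le]
  have h6 : (N - 1) * s - (N * y - 15 / 8 * y) = (s - p) * (N - 1) + 7 / (8 * y) := by
    rw [hp, ← hy2]
    field_simp
    ring
  have h7 : |7 / (8 * y)| ≤ 1 := by
    rw [abs_of_pos (by positivity), div_le_one (by positivity)]
    linarith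
  rw [h6]
  refine (abs_add_le _ _).trans ?_
  rw [abs_mul, abs_of_pos (by linarith : 0 < N - 1)]
  linarith

end PlaneTree

/-! ### Expansion of the moments in powers of `√(1 - 4 X)` -/

theorem Polynomial.exists_eq_sum_add_X_pow_mul (p : Polynomial ℝ) (N : ℕ) :
    ∃ V, p = ∑ i ∈ Finset.range N, C (p.coeff i) * X ^ i + X ^ N * V := by
  obtain ⟨V, hV⟩ : X ^ N ∣ p - ∑ i ∈ Finset.range N, C (p.coeff i) * X ^ i := by
    rw [X_pow_dvd_iff]
    intro d hd
    simp [coeff_X_pow, hd]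
  exact ⟨V, by rw [← hV]; ring⟩

theorem Polynomial.coeff_one_sub_X_pow_le_four (n : ℕ) :
    (((1 : Polynomial ℝ) - X) ^ n).coeff 0 = 1 ∧
    (((1 : Polynomial ℝ) - X) ^ n).coeff 1 = -(n : ℝ) ∧
    (((1 : Polynomial ℝ) - X) ^ n).coeff 2 = (n : ℝ) * (n - 1) / 2 ∧
    (((1 : Polynomial ℝ) - X) ^ n).coeff 3 = -((n : ℝ) * (n - 1) * (n - 2) / 6) ∧
    (((1 : Polynomial ℝ) - X) ^ n).coeff 4 = (n : ℝ) * (n - 1) * (n - 2) * (n - 3) / 24 := by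
  induction n with
  | zero => simp [coeff_one]
  | succ n ih =>
    obtain ⟨h0, h1, h2, h3, h4⟩ := ih
    simp only [pow_succ, mul_sub, mul_one, coeff_sub, coeff_mul_X, coeff_mul_X_zero, h0, h1, h2,
      h3, h4]
    push_cast
    refine ⟨?_, ?_, ?_, ?_, ?_⟩ <;> ring

/-- The first three coefficients of a polynomial are `a`, `b`, `c`. -/
def Polynomial.HasJet (p : Polynomial ℝ) (a b c : ℝ) : Prop :=
  p.coeff 0 = a ∧ p.coeff 1 = b ∧ p.coeff 2 = c

namespace Polynomial.HasJet

variable {p q : Polynomial ℝ} {a b c a' b' c' : ℝ}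

theorem add (hp : p.HasJet a b c) (hq : q.HasJet a' b' c') :
    (p + q).HasJet (a + a') (b + b') (c + c') := by
  simp [HasJet, hp.1, hp.2.1, hp.2.2, hq.1, hq.2.1, hq.2.2]

theorem sub (hp : p.HasJet a b c) (hq : q.HasJet a' b' c') :
    (p - q).HasJet (a - a') (b - b') (c - c') := by
  simp [HasJet, hp.1, hp.2.1, hp.2.2, hq.1, hq.2.1, hq.2.2]

theorem mul (hp : p.HasJet a b c) (hq : q.HasJet a' b' c') :
    (p * q).HasJet (a * a') (a * b' + b * a') (a * c' + b * b' + c * a') := by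
  obtain ⟨h0, h1, h2⟩ := hp
  obtain ⟨k0, k1, k2⟩ := hq
  refine ⟨?_, ?_, ?_⟩ <;>
    simp [coeff_mul, Finset.Nat.antidiagonal_succ, h0, h1, h2, k0, k1, k2, add_assoc]

theorem pow_two (hp : p.HasJet a b c) : (p ^ 2).HasJet (a * a) (a * b + b * a)
    (a * c + b * b + c * a) := by
  rw [_root_.pow_two]
  exact hp.mul hp

theorem pow_three (hp : p.HasJet a b c) : (p ^ 3).HasJet (a * a * a)
    (a * a * b + (a * b + b * a) * a)
    (a * a * c + (a * b + b * a) * b + (a * c + b * b + c * a) * a) := by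
  rw [pow_succ]
  exact hp.pow_two.mul hp

end Polynomial.HasJet

theorem Polynomial.hasJet_C (a : ℝ) : (C a).HasJet a 0 0 := by simp [HasJet, coeff_C]

theorem Polynomial.hasJet_one : (1 : Polynomial ℝ).HasJet 1 0 0 := by simp [HasJet, coeff_one]

theorem Polynomial.hasJet_X : (X : Polynomial ℝ).HasJet 0 1 0 := by simp [HasJet, coeff_X]

namespace PlaneTree

/-- The polynomial expressing `treeSeries 1` through `sqrtSeries`. -/
noncomputable def treePoly : Polynomial ℝ := Polynomial.C (1 / 2) * (1 - Polynomial.X)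

theorem aeval_treePoly : Polynomial.aeval sqrtSeries treePoly = treeSeries (1 : ℝ) := by
  have h : PowerSeries.C (1 / 2 : ℝ) * 2 = 1 := by
    rw [← map_ofNat PowerSeries.C 2, ← map_mul]
    norm_num
  rw [treePoly, map_mul, map_sub, map_one, Polynomial.aeval_X, Polynomial.aeval_C,
    PowerSeries.algebraMap_apply, Algebra.algebraMap_self, RingHom.id_apply, sqrtSeries]
  linear_combination treeSeries 1 * h

theorem hasJet_treePoly : treePoly.HasJet (1 / 2) (-1 / 2) 0 := by
  unfold treePoly
  convert (Polynomial.hasJet_C (1 / 2)).mul (Polynomial.hasJet_one.sub Polynomial.hasJet_X) using 1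
    <;> norm_num

theorem treePoly_pow (n : ℕ) :
    treePoly ^ n = Polynomial.C (1 / 2 ^ n) * (1 - Polynomial.X) ^ n := by
  rw [treePoly, mul_pow, ← map_pow, div_pow, one_pow]

theorem hasJet_treePoly_pow (r : ℕ) : (treePoly ^ (2 * r)).HasJet (1 / 4 ^ r)
    (-(2 * r) / 4 ^ r) (r * (2 * r - 1) / 4 ^ r) := by
  obtain ⟨h0, h1, h2, -, -⟩ := Polynomial.coeff_one_sub_X_pow_le_four (2 * r)
  rw [treePoly_pow, pow_mul]
  norm_num
  refine ⟨?_, ?_, ?_⟩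
  · rw [Polynomial.coeff_C_mul, h0]
    ring
  · rw [Polynomial.coeff_C_mul, h1]
    push_cast
    ring
  · rw [Polynomial.coeff_C_mul, h2]
    push_cast
    ring

/-- The third coefficient may stay unknown: the sum enters `secondMomentPoly` only with a factor
`X`. -/
theorem hasJet_geom_treePoly (r : ℕ) :
    ∃ c, (∑ i ∈ Finset.range r, treePoly ^ (2 * i)).HasJet (4 / 3 * (1 - 1 / 4 ^ r))
      (-8 / 9 + (8 * r / 3 + 8 / 9) / 4 ^ r) c := by
  induction r with
  | zero => exact ⟨0, by norm_num [Polynomial.HasJet]⟩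
  | succ r ih =>
    obtain ⟨c, hc⟩ := ih
    have := hc.add (hasJet_treePoly_pow r)
    rw [Finset.sum_range_succ]
    refine ⟨_, this.1.trans ?_, this.2.1.trans ?_, this.2.2⟩
    · rw [pow_succ]
      field_simp
      ring
    · rw [pow_succ]
      push_cast
      field_simp
      ring

/-- The numerator of the generating function of the second factorial moments, as a polynomial in
`sqrtSeries`. -/
noncomputable def secondMomentPoly (r : ℕ) : Polynomial ℝ :=
  Polynomial.C 2 * treePoly * treePoly ^ (2 * r) * (1 - treePoly) * Polynomial.X ^ 2
    + Polynomial.C 4 * treePoly ^ 3 * treePoly ^ (2 * r) * Polynomial.X ^ 2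
    + Polynomial.C 2 * treePoly ^ 3 * treePoly ^ (2 * r) * (1 - treePoly)
    + Polynomial.C 2 * Polynomial.X * treePoly ^ 2 * treePoly ^ (2 * r) *
      ((Polynomial.C 4 * treePoly ^ 2 - Polynomial.C 3 * treePoly + 1) -
        (1 - treePoly) ^ 3 * ∑ i ∈ Finset.range r, treePoly ^ (2 * i))

/-- After division by `s ^ 3` these coefficients belong to `s⁻³`, `s⁻²`, `s⁻¹`, that is, to leading
orders `n ^ 2`, `n ^ (3/2)`, `n` of the second factorial moment. -/
theorem hasJet_secondMomentPoly (r : ℕ) : (secondMomentPoly r).HasJet (1 / (8 * 4 ^ r))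
    (-((3 * r + 1) * 4 ^ r - 1) / (12 * (4 ^ r) ^ 2))
    (((18 * r ^ 2 + 3 * r + 16) * 4 ^ r + 2 - 24 * r) / (72 * (4 ^ r) ^ 2)) := by
  obtain ⟨c, hY⟩ := hasJet_geom_treePoly r
  have hT := hasJet_treePoly
  have hS := hasJet_treePoly_pow r
  have hX := Polynomial.hasJet_X
  have h1 := Polynomial.hasJet_one
  have hC := Polynomial.hasJet_C
  have := ((((((hC 2).mul hT).mul hS).mul (h1.sub hT)).mul hX.pow_two).add
    ((((hC 4).mul hT.pow_three).mul hS).mul hX.pow_two)).add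
    ((((hC 2).mul hT.pow_three).mul hS).mul (h1.sub hT)) |>.add
    (((((hC 2).mul hX).mul hT.pow_two).mul hS).mul
      (((((hC 4).mul hT.pow_two).sub ((hC 3).mul hT)).add h1).sub ((h1.sub hT).pow_three.mul hY)))
  have hG : (4 : ℝ) ^ r ≠ 0 := by positivity
  refine ⟨this.1.trans ?_, this.2.1.trans ?_, this.2.2.trans ?_⟩ <;> generalize (4 : ℝ) ^ r = G at *
  · field_simp
    ring
  · field_simp
    ring
  · field_simp
    ring

/-- The numerator of the singular part of the generating function of the first moments, as a
polynomial in `sqrtSeries`. -/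
noncomputable def firstMomentPoly (r : ℕ) : Polynomial ℝ :=
  treePoly * treePoly ^ (2 * r) * (1 - treePoly)

/-- Only even indices matter: after division by `s`, the odd ones go with `1`, `s ^ 2`, `s ^ 4`,
which are polynomials in the size variable. -/
theorem coeff_firstMomentPoly (r : ℕ) :
    (firstMomentPoly r).coeff 0 = 1 / (4 * 4 ^ r) ∧
    (firstMomentPoly r).coeff 2 = (2 * r + 1) * (r - 1) / (4 * 4 ^ r) ∧
    (firstMomentPoly r).coeff 4 =
      (2 * r + 1) * r * (2 * r - 1) * (r - 3) / (6 * (4 * 4 ^ r)) := by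
  obtain ⟨h0, h1, h2, h3, h4⟩ := Polynomial.coeff_one_sub_X_pow_le_four (2 * r + 1)
  have hP : firstMomentPoly r = Polynomial.C (1 / (4 * 4 ^ r)) *
      ((1 - Polynomial.X) ^ (2 * r + 1) + (1 - Polynomial.X) ^ (2 * r + 1) * Polynomial.X) := by
    have e1 : (1 : Polynomial ℝ) - treePoly = Polynomial.C (1 / 2) * (1 + Polynomial.X) := by
      have : (1 : Polynomial ℝ) = Polynomial.C (1 / 2) * 2 := by
        rw [← map_ofNat Polynomial.C 2, ← map_mul]
        norm_num
      rw [treePoly]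
      linear_combination this
    have e2 : (1 / (4 * 4 ^ r) : ℝ) = 1 / 2 ^ (2 * r + 1) * (1 / 2) := by
      rw [pow_succ, pow_mul]
      norm_num
      ring
    rw [firstMomentPoly, ← pow_succ', treePoly_pow, e1, e2, map_mul]
    ring
  rw [hP]
  simp only [Polynomial.coeff_C_mul, Polynomial.coeff_add, Polynomial.coeff_mul_X,
    Polynomial.coeff_mul_X_zero, h0, h1, h2, h3, h4]
  push_cast
  refine ⟨?_, ?_, ?_⟩ <;> field_simp <;> ring

/-- Catalan–Stanley trees of size `m + 2` are equinumerous with plane trees of size `m + 1`. -/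
theorem coeff_innerCoeff_zero (r m : ℕ) :
    (innerCoeff 0 (ancestorSeries (1 + Polynomial.X) r)).coeff (m + 2) = treeCount m := by
  rw [(ancestorSeries_coeffs r rfl rfl rfl rfl).1, PowerSeries.coeff_succ_X_mul, treeCount]
  simp [PowerSeries.coeff_one]

theorem one_sub_two_mul_treeSeries : 1 - 2 * treeSeries (1 : ℝ) = sqrtSeries := rfl

theorem innerCoeff_one_eq (r : ℕ) :
    innerCoeff 1 (ancestorSeries (1 + Polynomial.X) r) = PowerSeries.X *
      (1 + treeSeries 1 + Polynomial.aeval sqrtSeries (firstMomentPoly r) * sqrtSeries⁻¹) := by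
  have h := (ancestorSeries_coeffs r rfl rfl rfl rfl).2.1
  have hU : Polynomial.aeval sqrtSeries (firstMomentPoly r) = treeSeries (1 : ℝ) *
      treeSeries 1 ^ (2 * r) * (1 - treeSeries 1) := by
    simp only [firstMomentPoly, map_mul, map_pow, map_sub, map_one, aeval_treePoly]
  rw [one_sub_two_mul_treeSeries] at h
  rw [hU]
  have h1 := sqrtSeries_mul_inv
  apply mul_right_cancel₀ sqrtSeries_ne_zero
  linear_combination h - PowerSeries.X * (treeSeries 1 * treeSeries 1 ^ (2 * r) *
    (1 - treeSeries 1)) * h1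

theorem two_mul_innerCoeff_two_eq (r : ℕ) :
    2 * innerCoeff 2 (ancestorSeries (1 + Polynomial.X) r) = PowerSeries.X *
      (Polynomial.aeval sqrtSeries (secondMomentPoly r) * sqrtSeries⁻¹ ^ 3) := by
  have h := (ancestorSeries_coeffs r rfl rfl rfl rfl).2.2
  have hW : Polynomial.aeval sqrtSeries (secondMomentPoly r) =
      2 * treeSeries 1 * treeSeries 1 ^ (2 * r) * (1 - treeSeries 1) * sqrtSeries ^ 2
        + 4 * treeSeries 1 ^ 3 * treeSeries 1 ^ (2 * r) * sqrtSeries ^ 2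
        + 2 * treeSeries 1 ^ 3 * treeSeries 1 ^ (2 * r) * (1 - treeSeries 1)
        + 2 * sqrtSeries * treeSeries 1 ^ 2 * treeSeries 1 ^ (2 * r) *
          ((4 * treeSeries 1 ^ 2 - 3 * treeSeries 1 + 1) -
            (1 - treeSeries 1) ^ 3 * ∑ i ∈ Finset.range r, treeSeries 1 ^ (2 * i)) := by
    simp only [secondMomentPoly, map_mul, map_pow, map_sub, map_one, map_add, map_sum,
      aeval_treePoly, Polynomial.aeval_X, map_ofNat]
  rw [one_sub_two_mul_treeSeries, ← hW] at h
  have h1 : sqrtSeries ^ 3 * sqrtSeries⁻¹ ^ 3 = 1 := by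
    rw [← mul_pow, sqrtSeries_mul_inv, one_pow]
  apply mul_right_cancel₀ (pow_ne_zero 3 sqrtSeries_ne_zero)
  linear_combination h - PowerSeries.X *
    Polynomial.aeval sqrtSeries (secondMomentPoly r) * h1

theorem aeval_C_eq (a : ℝ) :
    Polynomial.aeval sqrtSeries (Polynomial.C a) = PowerSeries.C a := by
  rw [Polynomial.aeval_C, PowerSeries.algebraMap_apply, Algebra.algebraMap_self,
    RingHom.id_apply]

theorem coeff_sqrtSeries_sq {m : ℕ} (hm : 1 ≤ m) : (sqrtSeries ^ 2).coeff (m + 1) = 0 := by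
  rw [sqrtSeries_sq, ← map_ofNat PowerSeries.C 4, map_sub, PowerSeries.coeff_C_mul,
    PowerSeries.coeff_X, PowerSeries.coeff_one, if_neg (by omega), if_neg (by omega)]
  simp

theorem coeff_sqrtSeries_pow_four {m : ℕ} (hm : 2 ≤ m) :
    (sqrtSeries ^ 4).coeff (m + 1) = 0 := by
  have h := coeff_sqrtSeries_pow_succ 2 m
  obtain ⟨m, rfl⟩ := Nat.exists_eq_add_of_le' hm
  rw [coeff_sqrtSeries_sq (by omega), mul_zero] at h
  exact (mul_eq_zero.1 h).resolve_right (by positivity)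

/-! ### Asymptotics with explicit remainders -/

theorem expectation_bound (r : ℕ) : ∃ A : ℝ, ∀ m : ℕ, 2 ≤ m →
    |(∫ t, ancestorSize r t ∂(uniformCS (m + 2))) -
      (1 + (4 * m + 2) * (1 / (4 * 4 ^ r)) - 2 * ((2 * r + 1) * (r - 1) / (4 * 4 ^ r)) +
        6 / (2 * m - 1) * ((2 * r + 1) * r * (2 * r - 1) * (r - 3) / (6 * (4 * 4 ^ r))))| ≤
      A / (m + 1) ^ 2 := by
  -- Cutting at degree `6` leaves `s ^ 5` after division by `s`, hence a relative error of order
  -- `m⁻²`.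
  obtain ⟨V, hV⟩ := (firstMomentPoly r).exists_eq_sum_add_X_pow_mul 6
  obtain ⟨h0, h2, h4⟩ := coeff_firstMomentPoly r
  obtain ⟨A, hA⟩ := coeffBound_pow_mul_aeval (j := 2) (k := 5) (by norm_num) V
  refine ⟨A, fun m hm => ?_⟩
  have hκ := zero_lt_one.trans_le (one_le_treeCount m)
  have hU : Polynomial.aeval sqrtSeries (firstMomentPoly r) * sqrtSeries⁻¹ =
      PowerSeries.C ((firstMomentPoly r).coeff 0) * sqrtSeries⁻¹ +
      PowerSeries.C ((firstMomentPoly r).coeff 1) +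
      PowerSeries.C ((firstMomentPoly r).coeff 2) * sqrtSeries +
      PowerSeries.C ((firstMomentPoly r).coeff 3) * sqrtSeries ^ 2 +
      PowerSeries.C ((firstMomentPoly r).coeff 4) * sqrtSeries ^ 3 +
      PowerSeries.C ((firstMomentPoly r).coeff 5) * sqrtSeries ^ 4 +
      sqrtSeries ^ 5 * Polynomial.aeval sqrtSeries V := by
    conv_lhs => rw [hV]
    simp only [Finset.sum_range_succ, Finset.sum_range_zero, map_add, map_mul, map_pow,
      Polynomial.aeval_X, aeval_C_eq, map_zero]
    generalize (firstMomentPoly r).coeff = c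
    linear_combination (PowerSeries.C (c 1) + PowerSeries.C (c 2) * sqrtSeries +
      PowerSeries.C (c 3) * sqrtSeries ^ 2 + PowerSeries.C (c 4) * sqrtSeries ^ 3 +
      PowerSeries.C (c 5) * sqrtSeries ^ 4 +
      sqrtSeries ^ 5 * Polynomial.aeval sqrtSeries V) * sqrtSeries_mul_inv
  have hT : (treeSeries (1 : ℝ)).coeff (m + 1) = treeCount m := rfl
  rw [expectation_ancestorSize, coeff_innerCoeff_zero, innerCoeff_one_eq,
    PowerSeries.coeff_succ_X_mul, hU]
  simp only [map_add, PowerSeries.coeff_C_mul, PowerSeries.coeff_one, PowerSeries.coeff_C,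
    coeff_sqrtSeries_inv_succ, coeff_succ_sqrtSeries, coeff_sqrtSeries_sq (by omega : 1 ≤ m),
    coeff_sqrtSeries_cube (by omega : 1 ≤ m), coeff_sqrtSeries_pow_four hm, h0, h2, h4,
    Nat.add_eq_zero_iff, one_ne_zero, and_false, if_false, hT]
  have hA' := hA m
  set e := (PowerSeries.coeff (m + 1)) (sqrtSeries ^ 5 * Polynomial.aeval sqrtSeries V)
  have : |e / treeCount m| ≤ A / (m + 1) ^ 2 := by
    rw [abs_div, abs_of_pos hκ, div_le_iff₀ hκ]
    exact hA'.trans_eq (by ring)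
  refine le_of_eq_of_le (congrArg _ ?_) this
  field_simp
  ring

theorem second_moment_bound (r : ℕ) : ∃ A : ℝ, ∀ m : ℕ,
    |2 * (innerCoeff 2 (ancestorSeries (1 + Polynomial.X) r)).coeff (m + 2) / treeCount m -
      ((2 * m + 3) * (4 * m + 2) * (secondMomentPoly r).coeff 0 +
        4 ^ (m + 1) / treeCount m * (secondMomentPoly r).coeff 1 +
        (4 * m + 2) * (secondMomentPoly r).coeff 2)| ≤ A := by
  -- Cutting at degree `4` leaves `s` after division by `s ^ 3`, hence a bounded relative error.
  obtain ⟨V, hV⟩ := (secondMomentPoly r).exists_eq_sum_add_X_pow_mul 4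
  obtain ⟨A, hA⟩ := coeffBound_pow_mul_aeval (j := 0) (k := 1) (by norm_num) V
  refine ⟨A, fun m => ?_⟩
  have hκ := zero_lt_one.trans_le (one_le_treeCount m)
  have hW : Polynomial.aeval sqrtSeries (secondMomentPoly r) * sqrtSeries⁻¹ ^ 3 =
      PowerSeries.C ((secondMomentPoly r).coeff 0) * sqrtSeries⁻¹ ^ 3 +
      PowerSeries.C ((secondMomentPoly r).coeff 1) * sqrtSeries⁻¹ ^ 2 +
      PowerSeries.C ((secondMomentPoly r).coeff 2) * sqrtSeries⁻¹ +
      PowerSeries.C ((secondMomentPoly r).coeff 3) +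
      sqrtSeries ^ 1 * Polynomial.aeval sqrtSeries V := by
    conv_lhs => rw [hV]
    simp only [Finset.sum_range_succ, Finset.sum_range_zero, map_add, map_mul, map_pow,
      Polynomial.aeval_X, aeval_C_eq, map_zero]
    generalize (secondMomentPoly r).coeff = c
    have h1 := sqrtSeries_mul_inv
    have h2 : sqrtSeries ^ 2 * sqrtSeries⁻¹ ^ 2 = 1 := by rw [← mul_pow, h1, one_pow]
    have h3 : sqrtSeries ^ 3 * sqrtSeries⁻¹ ^ 3 = 1 := by rw [← mul_pow, h1, one_pow]
    linear_combination PowerSeries.C (c 1) * sqrtSeries⁻¹ ^ 2 * h1 +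
      PowerSeries.C (c 2) * sqrtSeries⁻¹ * h2 +
      (PowerSeries.C (c 3) + sqrtSeries * Polynomial.aeval sqrtSeries V) * h3
  have h2 : 2 * (innerCoeff 2 (ancestorSeries (1 + Polynomial.X) r)).coeff (m + 2) =
      (2 * innerCoeff 2 (ancestorSeries (1 + Polynomial.X) r)).coeff (m + 2) := by
    rw [← map_ofNat PowerSeries.C 2, PowerSeries.coeff_C_mul]
  rw [h2, two_mul_innerCoeff_two_eq, PowerSeries.coeff_succ_X_mul, hW]
  simp only [map_add, PowerSeries.coeff_C_mul, PowerSeries.coeff_C,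
    coeff_sqrtSeries_inv_succ, coeff_sqrtSeries_inv_sq, coeff_sqrtSeries_inv_cube_succ,
    Nat.add_eq_zero_iff, one_ne_zero, and_false, if_false]
  have hA' := hA m
  set e := (PowerSeries.coeff (m + 1)) (sqrtSeries ^ 1 * Polynomial.aeval sqrtSeries V)
  have : |e / treeCount m| ≤ A := by
    rw [abs_div, abs_of_pos hκ, div_le_iff₀ hκ]
    simpa using hA'
  refine le_of_eq_of_le (congrArg _ ?_) this
  field_simp
  ring

theorem expectation_asymptotics (r : ℕ) : ∃ A : ℝ, 0 ≤ A ∧ ∀ n : ℕ, 4 ≤ n →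
    |(∫ t, ancestorSize r t ∂(uniformCS n)) -
      ((1 / 4 ^ r) * (n : ℝ) + (2 * 4 ^ r - 2 * (r : ℝ) ^ 2 + r - 2) / (2 * 4 ^ r)
        + ((2 * r + 1) * (2 * r - 1) * (r - 3) * r) / (2 * 4 ^ (r + 1)) * (n : ℝ)⁻¹)| ≤
      A / (n : ℝ) ^ 2 := by
  obtain ⟨A, hA⟩ := expectation_bound r
  set c : ℝ := ((2 * r + 1) * (2 * r - 1) * (r - 3) * r) / (2 * 4 ^ (r + 1)) with hc
  have hA0 : 0 ≤ A := by
    have := (abs_nonneg _).trans (hA 2 le_rfl)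
    by_contra h
    exact absurd this (not_le.2 (div_neg_of_neg_of_pos (not_le.1 h) (by positivity)))
  refine ⟨4 * A + 15 * |c|, by positivity, fun n hn => ?_⟩
  obtain ⟨m, rfl⟩ := Nat.exists_eq_add_of_le' (show 2 ≤ n by omega)
  have hm := hA m (by omega)
  have hm2 : (2 : ℝ) ≤ m := by exact_mod_cast (show 2 ≤ m by omega)
  set E := ∫ t, ancestorSize r t ∂(uniformCS (m + 2))
  push_cast
  have h5 : (0 : ℝ) < 2 * m - 1 := by linarith
  have e : ∀ x y : ℝ, E - y = (E - x) + (x - y) := fun x y => by ring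
  rw [e]
  -- The affine parts agree exactly; `5 * c / (n * (2 * m - 1))` is the difference between `2 * c /
  -- (2 * m - 1)` and `c / n`.
  refine (abs_add_le _ _).trans ((add_le_add hm (le_of_eq (b := |5 * c /
    (((m : ℝ) + 2) * (2 * m - 1))|) (congrArg _ ?_))).trans ?_)
  · rw [hc, pow_succ]
    have h6 : (m : ℝ) * 2 - 1 ≠ 0 := by linarith
    field_simp
    ring
  · rw [add_div]
    refine add_le_add ?_ ?_
    · rw [div_le_div_iff₀ (by positivity) (by positivity)]
      have : ((m : ℝ) + 2) ^ 2 ≤ 4 * (m + 1) ^ 2 := by nlinarith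
      nlinarith
    · rw [abs_div, abs_mul, abs_of_pos (by norm_num : (0 : ℝ) < 5),
        abs_of_pos (by positivity : 0 < ((m : ℝ) + 2) * (2 * m - 1)),
        div_le_div_iff₀ (by positivity) (by positivity)]
      have : ((m : ℝ) + 2) ^ 2 ≤ 3 * ((m + 2) * (2 * m - 1)) := by nlinarith
      nlinarith [abs_nonneg c]

-- The mean is `α n + β + δ` with `δ = O(1 / n)`, so its square is known up to `O(1)`, the cross
-- term `2 α n δ` being bounded. Both half-integer powers come from the single term `ω * 4 ^ (m + 1)
-- / treeCount m`.
set_option maxHeartbeats 800000 in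
theorem variance_asymptotics (r : ℕ) : ∃ B : ℝ, ∀ n : ℕ, 4 ≤ n →
    |variance (ancestorSize r) (uniformCS n) -
      (((2 ^ r + 1) * (2 ^ r - 1)) / 16 ^ r * (n : ℝ) ^ 2
        - (√Real.pi * (4 ^ r * (3 * r + 1) - 1)) / (3 * 16 ^ r) * (n * √n)
        + (18 * 4 ^ r * (r : ℝ) ^ 2 + 3 * 4 ^ r * r - 38 * 4 ^ r + 36 * (r : ℝ) ^ 2
            - 42 * r + 38) / (18 * 16 ^ r) * (n : ℝ)
        + (5 * √Real.pi * (4 ^ r * (3 * r + 1) - 1)) / (8 * 16 ^ r) * √n)| ≤ B := by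
  obtain ⟨A, hA⟩ := second_moment_bound r
  obtain ⟨A', hA'0, hA'⟩ := expectation_asymptotics r
  obtain ⟨w0, w1, w2⟩ := hasJet_secondMomentPoly r
  rw [w0, w1, w2] at hA
  set α : ℝ := 1 / 4 ^ r with hα
  set β : ℝ := (2 * 4 ^ r - 2 * (r : ℝ) ^ 2 + r - 2) / (2 * 4 ^ r) with hβ
  set c : ℝ := ((2 * r + 1) * (2 * r - 1) * (r - 3) * r) / (2 * 4 ^ (r + 1)) with hc
  set ω : ℝ := -((3 * r + 1) * 4 ^ r - 1) / (12 * (4 ^ r) ^ 2) with hω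
  set ω₂ : ℝ := ((18 * r ^ 2 + 3 * r + 16) * 4 ^ r + 2 - 24 * r) / (72 * (4 ^ r) ^ 2) with hω₂
  set ω₀ : ℝ := 1 / (8 * 4 ^ r) with hω₀
  -- The constant terms: `6 * ω₀ - 6 * ω₂` from the second factorial moment and `β - β ^ 2` from the
  -- mean and its square.
  obtain ⟨K, hK⟩ : ∃ K, K = 6 * ω₀ - 6 * ω₂ + β - β ^ 2 := ⟨_, rfl⟩
  obtain ⟨M, hM⟩ : ∃ M, M = |c| + A' := ⟨_, rfl⟩
  have hM0 : 0 ≤ M := by rw [hM]; positivity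
  refine ⟨|ω| * (16 * √Real.pi) + A + M + 2 * (|α| + |β|) * M + M ^ 2 + |K|, fun n hn => ?_⟩
  rw [variance_ancestorSize (by omega)]
  have hE := hA' n hn
  obtain ⟨m, rfl⟩ := Nat.exists_eq_add_of_le' (show 2 ≤ n by omega)
  rw [coeff_innerCoeff_zero]
  have hS := hA m
  have hR := abs_four_pow_div_treeCount_sub_le m
  set E := ∫ t, ancestorSize r t ∂(uniformCS (m + 2))
  set F := 2 * (innerCoeff 2 (ancestorSeries (1 + Polynomial.X) r)).coeff (m + 2) / treeCount m
  set R := 4 ^ (m + 1) / treeCount m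
  have hN : ((m + 2 : ℕ) : ℝ) = (m : ℝ) + 2 := by push_cast; ring
  rw [hN] at hE ⊢
  obtain ⟨N, hmN⟩ : ∃ N : ℝ, N = m + 2 := ⟨_, rfl⟩
  have hm0 : (0 : ℝ) ≤ m := m.cast_nonneg
  have hN1 : 1 ≤ N := by linarith
  have hmN' : (m : ℝ) = N - 2 := by linarith
  rw [← hmN] at hE hR ⊢
  rw [hmN'] at hS
  obtain ⟨δ, hδ⟩ : ∃ δ, E = α * N + β + δ := ⟨E - (α * N + β), by ring⟩
  have hδN : |δ| * N ≤ M := by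
    have h1 : δ = (E - (α * N + β + c * N⁻¹)) + c * N⁻¹ := by rw [hδ]; ring
    have h2 : |δ| ≤ A' / N ^ 2 + |c| / N := by
      rw [h1]
      refine (abs_add_le _ _).trans (add_le_add hE (le_of_eq ?_))
      rw [abs_mul, abs_inv, abs_of_pos (by linarith : 0 < N), div_eq_mul_inv]
    have h3 : A' / N ^ 2 ≤ A' / N :=
      div_le_div_of_nonneg_left hA'0 (by linarith) (by nlinarith)
    have h4 : |δ| ≤ M / N := by
      rw [hM, add_div]
      linarith
    rwa [le_div_iff₀ (by linarith)] at h4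
  have hδM : |δ| ≤ M := (le_mul_of_one_le_right (abs_nonneg δ) hN1).trans hδN
  have h16 : (16 : ℝ) ^ r = (4 ^ r) ^ 2 := by
    rw [← pow_mul, mul_comm, pow_mul]
    norm_num
  have h22 : ((2 : ℝ) ^ r + 1) * (2 ^ r - 1) = 4 ^ r - 1 := by
    have : (4 : ℝ) ^ r = 2 ^ r * 2 ^ r := by rw [← mul_pow]; norm_num
    rw [this]
    ring
  rw [h16, h22]
  have key : F + E - E ^ 2 -
      ((4 ^ r - 1) / (4 ^ r) ^ 2 * N ^ 2
        - (√Real.pi * (4 ^ r * (3 * r + 1) - 1)) / (3 * (4 ^ r) ^ 2) * (N * √N)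
        + (18 * 4 ^ r * (r : ℝ) ^ 2 + 3 * 4 ^ r * r - 38 * 4 ^ r + 36 * (r : ℝ) ^ 2
            - 42 * r + 38) / (18 * (4 ^ r) ^ 2) * N
        + (5 * √Real.pi * (4 ^ r * (3 * r + 1) - 1)) / (8 * (4 ^ r) ^ 2) * √N) =
      ω * (R - 4 * √Real.pi * (N * √N - 15 / 8 * √N)) +
      (F - ((2 * (N - 2) + 3) * (4 * (N - 2) + 2) * ω₀ + R * ω + (4 * (N - 2) + 2) * ω₂)) +
      δ - 2 * (α * N + β) * δ - δ ^ 2 + K := by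
    rw [hδ, hK, hω, hω₀, hω₂, hβ, hα]
    field_simp
    ring
  rw [key]
  have b1 : |ω * (R - 4 * √Real.pi * (N * √N - 15 / 8 * √N))| ≤ |ω| * (16 * √Real.pi) := by
    rw [abs_mul]
    exact mul_le_mul_of_nonneg_left hR (abs_nonneg _)
  have b2 : |2 * (α * N + β) * δ| ≤ 2 * (|α| + |β|) * M := by
    have : |α * N + β| ≤ (|α| + |β|) * N := by
      refine (abs_add_le _ _).trans ?_
      rw [abs_mul, abs_of_pos (by linarith : 0 < N)]
      linarith [mul_le_mul_of_nonneg_left hN1 (abs_nonneg β)]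
    rw [abs_mul, abs_mul, abs_two]
    calc 2 * |α * N + β| * |δ| ≤ 2 * ((|α| + |β|) * N) * |δ| := by gcongr
      _ = 2 * (|α| + |β|) * (|δ| * N) := by ring
      _ ≤ _ := by gcongr
  have b3 : |δ ^ 2| ≤ M ^ 2 := by
    rw [abs_pow]
    gcongr
  refine (abs_add_le _ _).trans (add_le_add ((abs_sub _ _).trans (add_le_add
    ((abs_sub _ _).trans (add_le_add ((abs_add_le _ _).trans (add_le_add
      ((abs_add_le _ _).trans (add_le_add b1 hS)) hδM)) b2)) b3)) le_rfl)

end PlaneTree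

theorem mainTheorem2 (r : ℕ) :
    ((fun n : ℕ =>
        (∫ t, PlaneTree.ancestorSize r t ∂(PlaneTree.uniformCS n)) -
          ((1 / 4 ^ r) * (n : ℝ)
            + (2 * 4 ^ r - 2 * (r : ℝ) ^ 2 + r - 2) / (2 * 4 ^ r)
            + ((2 * r + 1) * (2 * r - 1) * (r - 3) * r) / (2 * 4 ^ (r + 1)) * (n : ℝ)⁻¹))
      =O[atTop] fun n : ℕ => (n : ℝ) ^ (-(3 / 2) : ℝ)) ∧
    ((fun n : ℕ =>
        variance (PlaneTree.ancestorSize r) (PlaneTree.uniformCS n) -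
          (((2 ^ r + 1) * (2 ^ r - 1)) / 16 ^ r * (n : ℝ) ^ 2
            - (√Real.pi * (4 ^ r * (3 * r + 1) - 1)) / (3 * 16 ^ r) * (n : ℝ) ^ (3 / 2 : ℝ)
            + (18 * 4 ^ r * (r : ℝ) ^ 2 + 3 * 4 ^ r * r - 38 * 4 ^ r + 36 * (r : ℝ) ^ 2
                - 42 * r + 38) / (18 * 16 ^ r) * (n : ℝ)
            + (5 * √Real.pi * (4 ^ r * (3 * r + 1) - 1)) / (8 * 16 ^ r)
                * (n : ℝ) ^ (1 / 2 : ℝ)))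
      =O[atTop] fun _ : ℕ => (1 : ℝ)) := by
  constructor
  · obtain ⟨A, hA0, hA⟩ := PlaneTree.expectation_asymptotics r
    refine Asymptotics.IsBigO.of_bound A ?_
    filter_upwards [eventually_ge_atTop 4] with n hn
    have hn1 : (1 : ℝ) ≤ n := by exact_mod_cast (show 1 ≤ n by omega)
    rw [Real.norm_eq_abs, Real.norm_of_nonneg (by positivity)]
    refine (hA n hn).trans ?_
    rw [div_eq_mul_inv]
    refine mul_le_mul_of_nonneg_left ?_ hA0
    rw [← Real.rpow_natCast, ← Real.rpow_neg (by positivity)]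
    -- The error obtained is of order `n⁻²`, stronger than the required `n ^ (-3/2)`.
    exact Real.rpow_le_rpow_of_exponent_le hn1 (by norm_num)
  · obtain ⟨B, hB⟩ := PlaneTree.variance_asymptotics r
    refine Asymptotics.IsBigO.of_bound B ?_
    filter_upwards [eventually_ge_atTop 4] with n hn
    have hn0 : (0 : ℝ) < n := by exact_mod_cast (show 0 < n by omega)
    have h32 : (n : ℝ) ^ (3 / 2 : ℝ) = n * √n := by
      rw [Real.sqrt_eq_rpow, show (3 / 2 : ℝ) = 1 + 1 / 2 by norm_num, Real.rpow_add hn0,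
        Real.rpow_one]
    rw [Real.norm_eq_abs, norm_one, mul_one, h32, ← Real.sqrt_eq_rpow]
    exact hB n hn
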